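/- Let $k$ be a field and let $A$ be a finite-dimensional $k$-algebra of finite CM-type, i.e. there are only finitely many isomorphism classes of indecomposable finitely generated Gorenstein-projective left $A$-modules. Here a finitely generated module $G$ is Gorenstein-projective if $G\cong\operatorname{Ker}d^0$ for an exact complex $(P^i,d^i)_{i\in\mathbb Z}$ of finitely generated projective modules that stays exact under $\operatorname{Hom}_A(-,P)$ for every finitely generated projective $P$. Let $E=\bigoplus_i E_i$ be the Gorenstein-projective generator (one copy of each indecomposable finitely generated Gorenstein-projective module up to isomorphism), let $\Lambda=\operatorname{End}_A(E)^{op}$ be the CM-Auslander algebra, and regard $\operatorname{Hom}_A(E,M)$ as a left $\Lambda$-module. Let $M$ be a finitely generated left $A$-module. Definitions. A surjection $X\to Y$ is a $G$-epimorphism if $\operatorname{Hom}_A(G,X)\to\operatorname{Hom}_A(G,Y)$ is surjective for every finitely generated Gorenstein-projective $G$; a short exact sequence is $G$-exact if its second map is a $G$-epimorphism. A proper Gorenstein-projective presentation of $M$ is an exact sequence $G_1\xrightarrow{f}G_0\xrightarrow{g}M\to0$ with $G_0,G_1$ finitely generated Gorenstein-projective that stays exact under $\operatorname{Hom}_A(G,-)$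 for every finitely generated Gorenstein-projective $G$; it is minimal if $G_0\to M$ and $G_1\to\operatorname{Im}f$ are right minimal (a map $h$ is right minimal if every endomorphism $e$ of its source with $he=h$ is an automorphism). For a minimal one, $\tau_GM:=\operatorname{Ker}\big(D\operatorname{Hom}_A(G_1,E)\to D\operatorname{Hom}_A(G_0,E)\big)$, a left $\Lambda$-module, where $D=\operatorname{Hom}_k(-,k)$; $M$ is $\tau_G$-rigid if $\operatorname{Hom}_\Lambda(\operatorname{Hom}_A(E,M),\tau_GM)=0$. A $\Lambda$-module $N$ is $\tau$-rigid if $\operatorname{Hom}_\Lambda(N,\tau N)=0$, where $\tau N=\operatorname{Ker}\big(D\operatorname{Hom}_\Lambda(P_1,\Lambda)\to D\operatorname{Hom}_\Lambda(P_0,\Lambda)\big)$ for a minimal projective presentation $P_1\to P_0\to N\to0$. For $\theta:G_1\to G_0$ let $D_\theta$ be the class of all (not necessarily finitely generated) $A$-modules $X$ with $\operatorname{Hom}_A(\theta,X)$ surjective. $M$ is partial Gorenstein silting if it has a proper Gorenstein-projective presentation given by some $\theta$ such that $D_\theta$ is closed under $G$-epimorphic images, $G$-extensions and coproducts, and $M\in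 D_\theta$. $\operatorname{Gen}_GM$ is the class of modules $Y$ admitting a $G$-epimorphism $T_0\to Y$ with $T_0$ a direct summand of a direct sum of copies of $M$. Theorem. $M$ has a minimal proper Gorenstein-projective presentation, $\operatorname{Hom}_A(E,M)$ has a minimal projective presentation over $\Lambda$, and the following hold. (a) $M$ is $\tau_G$-rigid if and only if $M$ is partial Gorenstein silting. (b) $M$ is $\tau_G$-rigid if and only if $\operatorname{Hom}_A(E,M)$ is a $\tau$-rigid $\Lambda$-module. For every minimal proper Gorenstein-projective presentation $G_1\xrightarrow{f}G_0\to M\to0$, with $\tau_GM$ computed from it: (c) $M$ is $\tau_G$-rigid if and only if $\operatorname{Hom}_A(f,M):\operatorname{Hom}_A(G_0,M)\to\operatorname{Hom}_A(G_1,M)$ is surjective. (d) $\tau_GM\cong\tau\operatorname{Hom}_A(E,M)$ as $\Lambda$-modules, with $\tau$ computed from any minimal projective presentation of $\operatorname{Hom}_A(E,M)$. (e) If $M$ is $\tau_G$-rigid, then for every finitely generated $Y\in\operatorname{Gen}_GM$ the $\Lambda$-module $\operatorname{Hom}_A(E,Y)$ is finitely generated and every homomorphism $\operatorname{Hom}_A(E,Y)\to\tau_GM$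 factors through a finitely generated injective $\Lambda$-module. -/

import Mathlib

universe u

namespace GorensteinSilting

open MulOpposite

section GorensteinProjective

/-- A finitely generated module `G` is Gorenstein-projective if it is isomorphic to `Ker d⁰` for an
exact complex `P` of finitely generated projective modules, indexed by `ℤ`, which stays exact after
applying `Hom_A(-, Q)` for every finitely generated projective module `Q`. -/
def IsGorensteinProjective (A : Type u) [Ring A] (G : Type u) [AddCommGroup G] [Module A G] :
    Prop :=
  Module.Finite A G ∧
  ∃ (P : ℤ → ModuleCat.{u} A) (d : ∀ i : ℤ, P i →ₗ[A] P (i + 1)),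
    (∀ i, Module.Finite A (P i) ∧ Module.Projective A (P i)) ∧
    (∀ i, Function.Exact (d i) (d (i + 1))) ∧
    (∀ (Q : Type u) [AddCommGroup Q] [Module A Q], Module.Finite A Q → Module.Projective A Q →
      ∀ i, Function.Exact
        (fun h : P (i + 1 + 1) →ₗ[A] Q => h ∘ₗ d (i + 1))
        (fun h : P (i + 1) →ₗ[A] Q => h ∘ₗ d i)) ∧
    Nonempty (G ≃ₗ[A] LinearMap.ker (d 0))

/-- Nonzero, and not a direct sum of two nonzero submodules. -/
def IsIndecomposable (A : Type u) [Ring A] (X : Type u) [AddCommGroup X] [Module A X] : Prop :=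
  Nontrivial X ∧ ∀ p q : Submodule A X, IsCompl p q → p = ⊥ ∨ q = ⊥

/-- There are only finitely many isomorphism classes of indecomposable finitely generated
Gorenstein-projective modules. -/
def FiniteCMType (A : Type u) [Ring A] : Prop :=
  ∃ (n : ℕ) (X : Fin n → ModuleCat.{u} A),
    ∀ (G : Type u) [AddCommGroup G] [Module A G], IsGorensteinProjective A G →
      IsIndecomposable A G → ∃ i, Nonempty (G ≃ₗ[A] X i)

/-- `E` is (isomorphic to) the direct sum of a complete, irredundant, finite list of
representatives of the indecomposable finitely generated Gorenstein-projective modules. -/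
def IsGorensteinProjectiveGenerator (A : Type u) [Ring A] (E : Type u) [AddCommGroup E]
    [Module A E] : Prop :=
  ∃ (n : ℕ) (X : Fin n → ModuleCat.{u} A),
    (∀ i, IsGorensteinProjective A (X i) ∧ IsIndecomposable A (X i)) ∧
    (∀ i j, Nonempty (X i ≃ₗ[A] X j) → i = j) ∧
    (∀ (G : Type u) [AddCommGroup G] [Module A G], IsGorensteinProjective A G →
      IsIndecomposable A G → ∃ i, Nonempty (G ≃ₗ[A] X i)) ∧
    Nonempty (E ≃ₗ[A] (∀ i, X i))

end GorensteinProjective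

section Presentations

variable {A : Type u} [Ring A]

/-- `Hom_A(G, X) → Hom_A(G, Y)` is surjective for every (finitely generated)
Gorenstein-projective `G`, and `X → Y` is surjective. -/
def IsGEpi {X Y : Type u} [AddCommGroup X] [Module A X] [AddCommGroup Y] [Module A Y]
    (p : X →ₗ[A] Y) : Prop :=
  Function.Surjective p ∧
  ∀ (G : Type u) [AddCommGroup G] [Module A G], IsGorensteinProjective A G →
    Function.Surjective (fun h : G →ₗ[A] X => p ∘ₗ h)

/-- The short exact sequence `0 → X → Y → Z → 0` is `G`-exact. (Applying `Hom_A(G, -)` can only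
destroy exactness at the right-hand end.) -/
def IsGExact {X Y Z : Type u} [AddCommGroup X] [Module A X] [AddCommGroup Y] [Module A Y]
    [AddCommGroup Z] [Module A Z] (i : X →ₗ[A] Y) (p : Y →ₗ[A] Z) : Prop :=
  Function.Injective i ∧ Function.Exact i p ∧ IsGEpi p

/-- `G₁ → G₀ → M → 0` is a proper Gorenstein-projective presentation of `M`. -/
structure IsProperPresentation {G₁ G₀ M : Type u} [AddCommGroup G₁] [Module A G₁]
    [AddCommGroup G₀] [Module A G₀] [AddCommGroup M] [Module A M]
    (f : G₁ →ₗ[A] G₀) (g : G₀ →ₗ[A] M) : Prop where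
  gproj₁ : IsGorensteinProjective A G₁
  gproj₀ : IsGorensteinProjective A G₀
  exact : Function.Exact f g
  surjective : Function.Surjective g
  hom_exact : ∀ (G : Type u) [AddCommGroup G] [Module A G], IsGorensteinProjective A G →
    Function.Exact (fun h : G →ₗ[A] G₁ => f ∘ₗ h) (fun h : G →ₗ[A] G₀ => g ∘ₗ h)
  hom_surjective : ∀ (G : Type u) [AddCommGroup G] [Module A G], IsGorensteinProjective A G →
    Function.Surjective (fun h : G →ₗ[A] G₀ => g ∘ₗ h)

/-- Every endomorphism `e` of the source with `f e = f` is an automorphism. -/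
def IsRightMinimal {X Y : Type u} [AddCommGroup X] [Module A X] [AddCommGroup Y] [Module A Y]
    (f : X →ₗ[A] Y) : Prop :=
  ∀ e : X →ₗ[A] X, f ∘ₗ e = f → Function.Bijective e

/-- A proper Gorenstein-projective presentation is minimal if the right approximations
`G₁ → Im f` and `G₀ → M` are right minimal. -/
structure IsMinimalProperPresentation {G₁ G₀ M : Type u} [AddCommGroup G₁] [Module A G₁]
    [AddCommGroup G₀] [Module A G₀] [AddCommGroup M] [Module A M]
    (f : G₁ →ₗ[A] G₀) (g : G₀ →ₗ[A] M) : Prop extends IsProperPresentation f g where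
  minimal₁ : IsRightMinimal f.rangeRestrict
  minimal₀ : IsRightMinimal g

/-- `p` is a projective cover: `P` is finitely generated projective, and `p` is surjective with
superfluous kernel. -/
structure IsProjectiveCover {P N : Type u} [AddCommGroup P] [Module A P]
    [AddCommGroup N] [Module A N] (p : P →ₗ[A] N) : Prop where
  finite : Module.Finite A P
  projective : Module.Projective A P
  surjective : Function.Surjective p
  superfluous : ∀ L : Submodule A P, LinearMap.ker p ⊔ L = ⊤ → L = ⊤

/-- `P₁ → P₀ → N → 0` is a minimal projective presentation of `N`. -/
structure IsMinimalProjectivePresentation {P₁ P₀ N : Type u} [AddCommGroup P₁] [Module A P₁]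
    [AddCommGroup P₀] [Module A P₀] [AddCommGroup N] [Module A N]
    (p : P₁ →ₗ[A] P₀) (q : P₀ →ₗ[A] N) : Prop where
  exact : Function.Exact p q
  cover₁ : IsProjectiveCover p.rangeRestrict
  cover₀ : IsProjectiveCover q

end Presentations

section Silting

variable {A : Type u} [Ring A]

/-- The class `D_θ` of all modules `X` (not necessarily finitely generated) such that
`Hom_A(θ, X)` is surjective. -/
def DClass {G₁ G₀ : Type u} [AddCommGroup G₁] [Module A G₁] [AddCommGroup G₀] [Module A G₀]
    (θ : G₁ →ₗ[A] G₀) : Set (ModuleCat.{u} A) :=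
  {X | Function.Surjective (fun h : G₀ →ₗ[A] X => h ∘ₗ θ)}

/-- Closed under `G`-epimorphic images, `G`-extensions and (arbitrary) coproducts. -/
structure IsRelativeTorsionClass (𝒟 : Set (ModuleCat.{u} A)) : Prop where
  image : ∀ (X Y : ModuleCat.{u} A) (p : X →ₗ[A] Y), IsGEpi p → X ∈ 𝒟 → Y ∈ 𝒟
  extension : ∀ (X Y Z : ModuleCat.{u} A) (i : X →ₗ[A] Y) (p : Y →ₗ[A] Z), IsGExact i p →
    X ∈ 𝒟 → Z ∈ 𝒟 → Y ∈ 𝒟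
  coproduct : ∀ (ι : Type u) (X : ι → ModuleCat.{u} A), (∀ i, X i ∈ 𝒟) →
    ModuleCat.of A (DirectSum ι (fun i => X i)) ∈ 𝒟

/-- `T` is a partial Gorenstein silting module. -/
def IsPartialGorensteinSilting (A : Type u) [Ring A] (T : Type u) [AddCommGroup T] [Module A T] :
    Prop :=
  ∃ (G₁ G₀ : ModuleCat.{u} A) (θ : G₁ →ₗ[A] G₀) (g : G₀ →ₗ[A] T),
    IsProperPresentation θ g ∧ IsRelativeTorsionClass (DClass θ) ∧ ModuleCat.of A T ∈ DClass θ

/-- `X` lies in `Add T`: it is a direct summand of a direct sum of copies of `T`. -/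
def InAdd (A : Type u) [Ring A] (T X : Type u) [AddCommGroup T] [Module A T] [AddCommGroup X]
    [Module A X] : Prop :=
  ∃ (ι : Type u) (i : X →ₗ[A] (ι →₀ T)) (r : (ι →₀ T) →ₗ[A] X), r ∘ₗ i = LinearMap.id

/-- `Y` lies in `Gen_G(T)`: there is a `G`-epimorphism `T₀ → Y` with `T₀` in `Add T`. -/
def InGenG (A : Type u) [Ring A] (T Y : Type u) [AddCommGroup T] [Module A T] [AddCommGroup Y]
    [Module A Y] : Prop :=
  ∃ (T₀ : ModuleCat.{u} A) (p : T₀ →ₗ[A] Y), InAdd A T T₀ ∧ IsGEpi p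

end Silting

section Bimodule

/-- The CM-Auslander algebra `A(Gproj) = End_A(E)^op`, for `E` the Gorenstein-projective
generator. -/
abbrev CMAuslander (A E : Type u) [Ring A] [AddCommGroup E] [Module A E] : Type u :=
  (Module.End A E)ᵐᵒᵖ

/-- `E` is an `A`-`End_A(E)^op`-bimodule: the right action of `op s` is `e ↦ s e`. -/
instance rightModule (A E : Type u) [Ring A] [AddCommGroup E] [Module A E] :
    Module (CMAuslander A E)ᵐᵒᵖ E :=
  Module.compHom E (RingEquiv.opOp (Module.End A E)).symm.toRingHom

theorem rightModule_smul (A E : Type u) [Ring A] [AddCommGroup E] [Module A E]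
    (l : (CMAuslander A E)ᵐᵒᵖ) (e : E) : l • e = (unop (unop l) : Module.End A E) e := rfl

instance rightModule_smulCommClass (A E : Type u) [Ring A] [AddCommGroup E] [Module A E] :
    SMulCommClass A (CMAuslander A E)ᵐᵒᵖ E where
  smul_comm a l e := by
    rw [rightModule_smul, rightModule_smul, map_smul]

instance rightModule_smulCommClass' (k A E : Type u) [Field k] [Ring A] [Algebra k A]
    [AddCommGroup E] [Module A E] [Module k E] [IsScalarTower k A E] :
    SMulCommClass (CMAuslander A E)ᵐᵒᵖ k E where
  smul_comm l c e := by
    rw [rightModule_smul, rightModule_smul, LinearMap.map_smul_of_tower]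

/-- `Hom_A(E, M)` as a left module over `End_A(E)^op`. -/
def HomE (A E M : Type u) [Ring A] [AddCommGroup E] [Module A E] [AddCommGroup M] [Module A M] :
    Type u :=
  E →ₗ[A] M

instance (A E M : Type u) [Ring A] [AddCommGroup E] [Module A E] [AddCommGroup M] [Module A M] :
    AddCommGroup (HomE A E M) :=
  inferInstanceAs (AddCommGroup (E →ₗ[A] M))

instance (A E M : Type u) [Ring A] [AddCommGroup E] [Module A E] [AddCommGroup M] [Module A M] :
    Module (CMAuslander A E) (HomE A E M) where
  smul s h := LinearMap.comp (h : E →ₗ[A] M) (unop s : E →ₗ[A] E)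
  one_smul h := LinearMap.comp_id (h : E →ₗ[A] M)
  mul_smul _ _ _ := rfl
  smul_zero _ := LinearMap.zero_comp _
  smul_add _ _ _ := LinearMap.add_comp _ _ _
  add_smul _ _ h := LinearMap.comp_add _ _ (h : E →ₗ[A] M)
  zero_smul h := LinearMap.comp_zero (h : E →ₗ[A] M)

theorem HomE.smul_def {A E M : Type u} [Ring A] [AddCommGroup E] [Module A E] [AddCommGroup M]
    [Module A M] (s : CMAuslander A E) (h : HomE A E M) :
    s • h = LinearMap.comp (h : E →ₗ[A] M) (unop s : E →ₗ[A] E) := rfl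

end Bimodule

section Translate

variable (k L A E : Type u) [Field k] [Ring L] [Ring A] [AddCommGroup E] [Module A E] [Module k E]
  [SMulCommClass A k E] [Module Lᵐᵒᵖ E] [SMulCommClass A Lᵐᵒᵖ E] [SMulCommClass Lᵐᵒᵖ k E]

/-- `D Hom_A(G, E)`, where `D` is the duality over the field `k`. If `E` is an `A`-`L`-bimodule,
then `Hom_A(G, E)` is a right `L`-module and `D Hom_A(G, E)` is a left `L`-module. -/
def DualHom (k A E G : Type u) [Field k] [Ring A] [AddCommGroup E] [Module A E] [Module k E]
    [SMulCommClass A k E] [AddCommGroup G] [Module A G] : Type u :=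
  Module.Dual k (G →ₗ[A] E)

instance (k A E G : Type u) [Field k] [Ring A] [AddCommGroup E] [Module A E] [Module k E]
    [SMulCommClass A k E] [AddCommGroup G] [Module A G] : AddCommGroup (DualHom k A E G) :=
  inferInstanceAs (AddCommGroup (Module.Dual k (G →ₗ[A] E)))

/-- The right action of `l : L` on `Hom_A(G, E)`, as a `k`-linear map. -/
def rightAction (G : Type u) [AddCommGroup G] [Module A G] (l : L) :
    (G →ₗ[A] E) →ₗ[k] (G →ₗ[A] E) where
  toFun h := op l • h
  map_add' h h' := smul_add (op l) h h'
  map_smul' c h := smul_comm (op l) c h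

instance dualHomModule (G : Type u) [AddCommGroup G] [Module A G] :
    Module L (DualHom k A E G) where
  smul l φ := LinearMap.comp (φ : Module.Dual k (G →ₗ[A] E)) (rightAction k L A E G l)
  one_smul φ := by
    refine LinearMap.ext (R := k) (M := G →ₗ[A] E) (M₃ := k) fun h => ?_
    exact congrArg (DFunLike.coe (F := Module.Dual k (G →ₗ[A] E)) φ) (one_smul Lᵐᵒᵖ h)
  mul_smul l l' φ := by
    refine LinearMap.ext (R := k) (M := G →ₗ[A] E) (M₃ := k) fun h => ?_
    exact congrArg (DFunLike.coe (F := Module.Dual k (G →ₗ[A] E)) φ) (mul_smul (op l') (op l) h)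
  smul_zero _ := LinearMap.zero_comp _
  smul_add _ _ _ := LinearMap.add_comp _ _ _
  add_smul l l' φ := by
    refine LinearMap.ext (R := k) (M := G →ₗ[A] E) (M₃ := k) fun h => ?_
    exact (congrArg (DFunLike.coe (F := Module.Dual k (G →ₗ[A] E)) φ)
      (add_smul (op l) (op l') h)).trans
      (LinearMap.map_add (M := G →ₗ[A] E) (M₃ := k) φ (op l • h) (op l' • h))
  zero_smul φ := by
    refine LinearMap.ext (R := k) (M := G →ₗ[A] E) (M₃ := k) fun h => ?_
    exact (congrArg (DFunLike.coe (F := Module.Dual k (G →ₗ[A] E)) φ) (zero_smul Lᵐᵒᵖ h)).trans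
      (LinearMap.map_zero (M := G →ₗ[A] E) (M₃ := k) φ)

theorem DualHom.smul_apply {G : Type u} [AddCommGroup G] [Module A G] (l : L)
    (φ : DualHom k A E G) (h : G →ₗ[A] E) :
    (show Module.Dual k (G →ₗ[A] E) from (l • φ : DualHom k A E G)) h =
      (show Module.Dual k (G →ₗ[A] E) from φ) (op l • h) := rfl

/-- The map `D Hom_A(f, E) : D Hom_A(G₁, E) → D Hom_A(G₀, E)`. -/
def dualHomMap {G₁ G₀ : Type u} [AddCommGroup G₁] [Module A G₁] [AddCommGroup G₀] [Module A G₀]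
    (f : G₁ →ₗ[A] G₀) : DualHom k A E G₁ →ₗ[L] DualHom k A E G₀ where
  toFun φ := LinearMap.comp (φ : Module.Dual k (G₁ →ₗ[A] E))
    ({ toFun := fun h => h ∘ₗ f
       map_add' := fun h h' => LinearMap.add_comp f h' h
       map_smul' := fun c h => LinearMap.smul_comp c h f } : (G₀ →ₗ[A] E) →ₗ[k] (G₁ →ₗ[A] E))
  map_add' _ _ := LinearMap.add_comp _ _ _
  map_smul' _ _ := LinearMap.ext (R := k) (M := G₀ →ₗ[A] E) (M₃ := k) fun _ => rfl

/-- `Ker (D Hom_A(G₁, E) → D Hom_A(G₀, E))` for `f : G₁ → G₀`, as a left `L`-module. -/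
abbrev translate {G₁ G₀ : Type u} [AddCommGroup G₁] [Module A G₁] [AddCommGroup G₀] [Module A G₀]
    (f : G₁ →ₗ[A] G₀) : Submodule L (DualHom k A E G₁) :=
  LinearMap.ker (dualHomMap k L A E f)

end Translate

section Tau

/-- `τ_G M`, computed from a minimal proper Gorenstein-projective presentation
`f : G₁ → G₀` of `M`: the kernel of `D Hom_A(G₁, E) → D Hom_A(G₀, E)`. -/
abbrev tauG (k A E : Type u) [Field k] [Ring A] [Algebra k A] [AddCommGroup E] [Module A E]
    [Module k E] [IsScalarTower k A E]
    {G₁ G₀ : Type u} [AddCommGroup G₁] [Module A G₁] [AddCommGroup G₀] [Module A G₀]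
    (f : G₁ →ₗ[A] G₀) : Submodule (CMAuslander A E) (DualHom k A E G₁) :=
  translate k (CMAuslander A E) A E f

/-- `M` is `τ_G`-rigid: `Hom(Hom_A(E, M), τ_G M) = 0` over `End_A(E)^op`. -/
def IsTauGRigid (k A E M : Type u) [Field k] [Ring A] [Algebra k A] [AddCommGroup E] [Module A E]
    [Module k E] [IsScalarTower k A E] [AddCommGroup M] [Module A M] : Prop :=
  ∃ (G₁ G₀ : ModuleCat.{u} A) (f : G₁ →ₗ[A] G₀) (g : G₀ →ₗ[A] M),
    IsMinimalProperPresentation f g ∧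
      ∀ φ : HomE A E M →ₗ[CMAuslander A E] tauG k A E f, φ = 0

/-- The Auslander-Reiten translation `τ = D Tr` over a finite-dimensional algebra `L`, computed
from a minimal projective presentation `p : P₁ → P₀`: the kernel of
`D Hom_L(P₁, L) → D Hom_L(P₀, L)`. -/
abbrev tau (k L : Type u) [Field k] [Ring L] [Algebra k L]
    {P₁ P₀ : Type u} [AddCommGroup P₁] [Module L P₁] [AddCommGroup P₀] [Module L P₀]
    (p : P₁ →ₗ[L] P₀) : Submodule L (DualHom k L L P₁) :=
  translate k L L L p

/-- `N` is `τ`-rigid: `Hom_L(N, τ N) = 0`. -/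
def IsTauRigid (k L N : Type u) [Field k] [Ring L] [Algebra k L] [AddCommGroup N] [Module L N] :
    Prop :=
  ∃ (P₁ P₀ : ModuleCat.{u} L) (p : P₁ →ₗ[L] P₀) (q : P₀ →ₗ[L] N),
    IsMinimalProjectivePresentation p q ∧ ∀ φ : N →ₗ[L] tau k L p, φ = 0

/-- `X` is finitely generated and every homomorphism `X → Y` factors through a finitely generated
injective module, i.e. the Hom space from `X` to `Y` modulo injectives vanishes. -/
def StablyOrthogonal (L X Y : Type u) [Ring L] [AddCommGroup X] [Module L X] [AddCommGroup Y]
    [Module L Y] : Prop :=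
  Module.Finite L X ∧
  ∀ φ : X →ₗ[L] Y, ∃ (I : ModuleCat.{u} L) (a : X →ₗ[L] I) (b : I →ₗ[L] Y),
    Module.Finite L I ∧ Module.Injective L I ∧ φ = b ∘ₗ a

end Tau

end GorensteinSilting

/-! Over the Artinian ring `A`, the finitely generated Gorenstein-projective modules are exactly the
summands of finite powers of `E` (`isGorensteinProjective_iff_isFinSummand`). One inclusion is
induction on length, the other is closure under finite sums and summands. On this class `Hom_A(E,
-)` is fully faithful with projective values, and `Hom_A(G, E)` becomes `Hom_Λ(Hom_A(E, G), Λ)`.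
Hence it sends minimal proper presentations to minimal projective presentations and identifies `τ_G
M` with `τ Hom_A(E, M)`, which gives (d) and (b).

Rigidity rests on a duality: for `G` a summand of a power of `E`, `Hom_Λ(Hom_A(E, M), D Hom_A(G,
E))` is `D Hom_A(G, M)`, naturally in `G`. So the maps from `Hom_A(E, M)` to the kernel attached to
`θ : G₁ → G₀` form the dual of the cokernel of `Hom_A(θ, M)`, and they all vanish iff `M` lies in
`D_θ`. The two halves are `eq_zero_of_surjective_precomp` and `surjective_precomp_of_eq_zero`.

The closure properties of `D_θ` hold for every `θ` between Gorenstein-projectives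
(`isRelativeTorsionClass_DClass`), so partial silting only asks for some proper presentation `θ`
with `M` in `D_θ`. A minimal presentation is a retract of any proper one, so membership passes to it
(`IsMinimalProperPresentation.surjective_precomp`); this gives (a) and (c). For (e), `Gen_G M` lies
in `D_f`, so the homomorphisms in question are all zero. -/

namespace GorensteinSilting

/-! ### Closure of Gorenstein-projectives under finite sums and summands. -/

section Closure

variable {A : Type u} [Ring A]

/-- There is a short exact sequence `0 → X → P → Y → 0` with `P` finitely generated projective
that stays exact under `Hom_A(-, Q)` for every finitely generated projective `Q`. -/
def IsHomExactStep (X Y : ModuleCat.{u} A) : Prop :=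
  ∃ (P : ModuleCat.{u} A) (i : X →ₗ[A] P) (p : P →ₗ[A] Y),
    Module.Finite A P ∧ Module.Projective A P ∧
    Function.Injective i ∧ Function.Exact i p ∧ Function.Surjective p ∧
    ∀ (Q : Type u) [AddCommGroup Q] [Module A Q], Module.Finite A Q → Module.Projective A Q →
      ∀ h : X →ₗ[A] Q, ∃ h' : P →ₗ[A] Q, h' ∘ₗ i = h

theorem IsHomExactStep.of_equiv {X Y X' Y' : ModuleCat.{u} A} (h : IsHomExactStep X Y)
    (eX : X' ≃ₗ[A] X) (eY : Y ≃ₗ[A] Y') : IsHomExactStep X' Y' := by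
  obtain ⟨P, i, p, hP, hP', hi, hip, hp, hQ⟩ := h
  refine ⟨P, i ∘ₗ eX.toLinearMap, eY.toLinearMap ∘ₗ p, hP, hP', ?_, ?_, ?_, ?_⟩
  · exact hi.comp eX.injective
  · intro x
    simp only [LinearMap.comp_apply, LinearEquiv.coe_coe, Set.mem_range,
      EmbeddingLike.map_eq_zero_iff]
    rw [hip x]
    constructor
    · rintro ⟨y, rfl⟩
      exact ⟨eX.symm y, by simp⟩
    · rintro ⟨y, rfl⟩
      exact ⟨eX y, rfl⟩
  · exact eY.surjective.comp hp
  · intro Q _ _ h1 h2 h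
    obtain ⟨h', hh'⟩ := hQ Q h1 h2 (h ∘ₗ eX.symm.toLinearMap)
    refine ⟨h', LinearMap.ext fun x => ?_⟩
    have := LinearMap.congr_fun hh' (eX x)
    simpa using this

theorem IsHomExactStep.prod {X Y X' Y' : ModuleCat.{u} A} (h : IsHomExactStep X Y)
    (h' : IsHomExactStep X' Y') :
    IsHomExactStep (ModuleCat.of A (X × X')) (ModuleCat.of A (Y × Y')) := by
  obtain ⟨P, i, p, hP, hPp, hi, hip, hp, hQ⟩ := h
  obtain ⟨P', i', p', hP', hPp', hi', hip', hp', hQ'⟩ := h'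
  refine ⟨ModuleCat.of A (P × P'), i.prodMap i', p.prodMap p', ?_, ?_, ?_, ?_, ?_, ?_⟩
  · exact inferInstanceAs (Module.Finite A (P × P'))
  · exact inferInstanceAs (Module.Projective A (P × P'))
  · exact hi.prodMap hi'
  · rintro ⟨x, x'⟩
    have h1 := hip x
    have h2 := hip' x'
    constructor
    · intro h
      obtain ⟨h3, h4⟩ := Prod.mk.inj h
      obtain ⟨a, ha⟩ := h1.1 h3
      obtain ⟨b, hb⟩ := h2.1 h4
      exact ⟨(a, b), Prod.ext ha hb⟩
    · rintro ⟨⟨a, b⟩, hab⟩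
      obtain ⟨h3, h4⟩ := Prod.mk.inj hab
      exact Prod.ext (h1.2 ⟨a, h3⟩) (h2.2 ⟨b, h4⟩)
  · exact hp.prodMap hp'
  · intro Q _ _ h1 h2 h
    let h0 : X × X' →ₗ[A] Q := h
    obtain ⟨a, ha⟩ := hQ Q h1 h2 (h0 ∘ₗ LinearMap.inl A X X')
    obtain ⟨b, hb⟩ := hQ' Q h1 h2 (h0 ∘ₗ LinearMap.inr A X X')
    refine ⟨(a.coprod b : P × P' →ₗ[A] Q), ?_⟩
    change (a.coprod b) ∘ₗ (i.prodMap i') = h0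
    apply LinearMap.prod_ext
    · rw [← ha]
      ext x
      simp
    · rw [← hb]
      ext x
      simp

theorem exists_int_chain {α : Type*} {R : α → α → Prop} {𝒮 : Set α}
    (hr : ∀ x ∈ 𝒮, ∃ y ∈ 𝒮, R x y) (hl : ∀ y ∈ 𝒮, ∃ x ∈ 𝒮, R x y) {x₀ : α} (hx₀ : x₀ ∈ 𝒮) :
    ∃ s : ℤ → α, s 0 = x₀ ∧ ∀ i, R (s i) (s (i + 1)) := by
  choose! nx hnx hnxR using hr
  choose! pv hpv hpvR using hl
  have hn : ∀ n : ℕ, nx^[n] x₀ ∈ 𝒮 := fun n => by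
    induction n with
    | zero => exact hx₀
    | succ n ih => rw [Function.iterate_succ_apply']; exact hnx _ ih
  have hp : ∀ n : ℕ, pv^[n] x₀ ∈ 𝒮 := fun n => by
    induction n with
    | zero => exact hx₀
    | succ n ih => rw [Function.iterate_succ_apply']; exact hpv _ ih
  -- `Int.negSucc n` is `-(n + 1)`, hence the exponent `n + 1` on the negative side.
  refine ⟨fun i => Int.casesOn i (fun n => nx^[n] x₀) (fun n => pv^[n + 1] x₀), rfl, ?_⟩
  rintro (n | n)
  · change R (nx^[n] x₀) (nx^[n + 1] x₀)
    rw [Function.iterate_succ_apply']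
    exact hnxR _ (hn n)
  · cases n with
    | zero =>
      change R (pv^[1] x₀) x₀
      exact hpvR _ hx₀
    | succ n =>
      have : Int.negSucc (n + 1) + 1 = Int.negSucc n := by omega
      rw [this]
      change R (pv^[n + 1 + 1] x₀) (pv^[n + 1] x₀)
      rw [Function.iterate_succ_apply' pv (n + 1)]
      exact hpvR _ (hp (n + 1))

/-- The finitely generated Gorenstein-projective modules contain every class of modules with
steps to the right and to the left inside the class. -/
theorem IsGorensteinProjective.of_mem_class {𝒮 : Set (ModuleCat.{u} A)}
    (hr : ∀ X ∈ 𝒮, ∃ Y ∈ 𝒮, IsHomExactStep X Y) (hl : ∀ Y ∈ 𝒮, ∃ X ∈ 𝒮, IsHomExactStep X Y)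
    {X : ModuleCat.{u} A} (hX : X ∈ 𝒮) : IsGorensteinProjective A X := by
  refine ⟨?_, ?_⟩
  · obtain ⟨Y, -, P, i, p, hP, -, -, -, hp, -⟩ := hl X hX
    exact Module.Finite.of_surjective p hp
  obtain ⟨s, rfl, hs⟩ := exists_int_chain hr hl hX
  choose P i p hP hP' hi hip hp hQ using hs
  have hcomp : ∀ j x, p j (i j x) = 0 := fun j x => (hip j _).2 ⟨x, rfl⟩
  -- The short exact sequences are spliced: the differential is `P j → s (j + 1) → P (j + 1)`.
  refine ⟨P, fun j => i (j + 1) ∘ₗ p j, fun j => ⟨hP j, hP' j⟩, ?_, ?_, ?_⟩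
  · intro j x
    simp only [LinearMap.comp_apply, Set.mem_range]
    rw [map_eq_zero_iff _ (hi _), hip]
    constructor
    · rintro ⟨y, rfl⟩
      obtain ⟨z, rfl⟩ := hp j y
      exact ⟨z, rfl⟩
    · rintro ⟨z, rfl⟩
      exact ⟨_, rfl⟩
  · intro Q _ _ h1 h2 j h
    constructor
    · intro hh
      have hz : ∀ x, h (i (j + 1) x) = 0 := fun x => by
        obtain ⟨z, rfl⟩ := hp j x
        exact LinearMap.congr_fun hh z
      have hk : LinearMap.ker (p (j + 1)) ≤ LinearMap.ker h := by
        intro x hx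
        obtain ⟨y, rfl⟩ := (hip _ _).1 hx
        exact hz y
      -- Since `h` kills the image of `i (j + 1)`, it descends along `p (j + 1)` to `s (j + 2)`;
      -- this map extends along `i (j + 2)`.
      obtain ⟨h', hh'⟩ := hQ (j + 1 + 1) Q h1 h2 ((LinearMap.ker (p (j + 1))).liftQ h hk ∘ₗ
        ((p (j + 1)).quotKerEquivOfSurjective (hp _)).symm.toLinearMap)
      refine ⟨h', LinearMap.ext fun x => ?_⟩
      have := LinearMap.congr_fun hh' (p (j + 1) x)
      simp only [LinearMap.comp_apply, LinearEquiv.coe_coe] at this ⊢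
      rw [this, LinearMap.quotKerEquivOfSurjective_symm_apply, Submodule.liftQ_apply]
    · rintro ⟨h', rfl⟩
      refine LinearMap.ext fun x => ?_
      simp [hcomp]
  · have hker : LinearMap.ker (i (0 + 1) ∘ₗ p 0) = LinearMap.range (i 0) := by
      ext x
      rw [LinearMap.mem_ker, LinearMap.comp_apply, map_eq_zero_iff _ (hi _), hip]
      rfl
    rw [hker]
    exact ⟨LinearEquiv.ofInjective (i 0) (hi 0)⟩

theorem IsGorensteinProjective.of_equiv {X Y : Type u} [AddCommGroup X] [Module A X]
    [AddCommGroup Y] [Module A Y] (h : IsGorensteinProjective A X) (e : Y ≃ₗ[A] X) :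
    IsGorensteinProjective A Y := by
  obtain ⟨h1, P, d, h2, h3, h4, ⟨e'⟩⟩ := h
  exact ⟨Module.Finite.equiv e.symm, P, d, h2, h3, h4, ⟨e.trans e'⟩⟩

/-- A complete resolution cuts into steps between consecutive kernels. The set of these kernels is
stable under steps both ways, so syzygies and cosyzygies are again Gorenstein-projective. -/
theorem exists_isHomExactStep {X : ModuleCat.{u} A} (h : IsGorensteinProjective A X) :
    (∃ Y : ModuleCat.{u} A, IsGorensteinProjective A Y ∧ IsHomExactStep X Y) ∧
    (∃ Y : ModuleCat.{u} A, IsGorensteinProjective A Y ∧ IsHomExactStep Y X) := by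
  obtain ⟨-, P, d, hP, hd, hQ, ⟨e⟩⟩ := h
  have step : ∀ j, IsHomExactStep (ModuleCat.of A (LinearMap.ker (d j)))
      (ModuleCat.of A (LinearMap.ker (d (j + 1)))) := by
    intro j
    obtain ⟨j, rfl⟩ : ∃ i, j = i + 1 + 1 := ⟨j - 1 - 1, by ring⟩
    refine ⟨P (j + 1 + 1), (LinearMap.ker (d (j + 1 + 1))).subtype,
      (d (j + 1 + 1)).codRestrict _ fun x => (hd _ _).2 ⟨x, rfl⟩, (hP _).1, (hP _).2,
      Subtype.val_injective, ?_, ?_, ?_⟩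
    · intro x
      constructor
      · intro h
        exact ⟨⟨x, congrArg Subtype.val h⟩, rfl⟩
      · rintro ⟨y, rfl⟩
        exact Subtype.ext y.2
    · rintro ⟨x, hx⟩
      obtain ⟨y, rfl⟩ := (hd _ _).1 hx
      exact ⟨y, rfl⟩
    · intro Q _ _ h1 h2 (h : LinearMap.ker (d (j + 1 + 1)) →ₗ[A] Q)
      obtain ⟨h', hh'⟩ := (hQ Q h1 h2 j (h ∘ₗ (d (j + 1)).codRestrict _
        fun x => (hd _ _).2 ⟨x, rfl⟩)).1 (by
          refine LinearMap.ext fun x => ?_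
          change h _ = 0
          convert map_zero h
          exact Subtype.ext ((hd j _).2 ⟨x, rfl⟩))
      refine ⟨h', LinearMap.ext ?_⟩
      rintro ⟨x, hx⟩
      obtain ⟨y, rfl⟩ := (hd _ _).1 hx
      exact LinearMap.congr_fun hh' y
  let 𝒮 : Set (ModuleCat.{u} A) := {Y | ∃ j, Y = ModuleCat.of A (LinearMap.ker (d j))}
  have hr : ∀ X ∈ 𝒮, ∃ Y ∈ 𝒮, IsHomExactStep X Y := by
    rintro _ ⟨j, rfl⟩
    exact ⟨_, ⟨j + 1, rfl⟩, step j⟩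
  have hl : ∀ X ∈ 𝒮, ∃ Y ∈ 𝒮, IsHomExactStep Y X := by
    rintro _ ⟨j, rfl⟩
    obtain ⟨j, rfl⟩ : ∃ i, j = i + 1 := ⟨j - 1, by ring⟩
    exact ⟨_, ⟨j, rfl⟩, step j⟩
  refine ⟨?_, ?_⟩
  · obtain ⟨Y, hY, hs⟩ := hr _ ⟨0, rfl⟩
    exact ⟨Y, .of_mem_class hr hl hY, hs.of_equiv e (.refl A _)⟩
  · obtain ⟨Y, hY, hs⟩ := hl _ ⟨0, rfl⟩
    exact ⟨Y, .of_mem_class hr hl hY, hs.of_equiv (.refl A _) e.symm⟩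

theorem IsGorensteinProjective.of_projective (P : Type u) [AddCommGroup P] [Module A P]
    [Module.Finite A P] [Module.Projective A P] : IsGorensteinProjective A P := by
  let 𝒮 : Set (ModuleCat.{u} A) := {Y | Module.Finite A Y ∧ Module.Projective A Y}
  have h0 : ModuleCat.of A PUnit.{u + 1} ∈ 𝒮 :=
    ⟨inferInstanceAs (Module.Finite A PUnit.{u + 1}),
      inferInstanceAs (Module.Projective A PUnit.{u + 1})⟩
  refine of_mem_class (𝒮 := 𝒮) (X := ModuleCat.of A P) ?_ ?_ ⟨‹_›, ‹_›⟩
  · rintro X ⟨h1, h2⟩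
    refine ⟨_, h0, X, LinearMap.id, 0, h1, h2, Function.injective_id, ?_, ?_, ?_⟩
    · intro x
      exact ⟨fun _ => ⟨x, rfl⟩, fun _ => rfl⟩
    · intro x
      exact ⟨0, Subsingleton.elim (α := PUnit) _ _⟩
    · intro Q _ _ _ _ h
      exact ⟨h, rfl⟩
  · rintro X ⟨h1, h2⟩
    refine ⟨_, h0, X, 0, LinearMap.id, h1, h2, ?_, ?_, Function.surjective_id, ?_⟩
    · intro x y _
      exact Subsingleton.elim (α := PUnit) _ _
    · intro x
      exact ⟨fun h => ⟨0, h.symm⟩, by rintro ⟨y, rfl⟩; rfl⟩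
    · intro Q _ _ _ _ h
      exact ⟨0, LinearMap.ext fun x => by
        rw [show x = 0 from Subsingleton.elim (α := PUnit) _ _, map_zero, map_zero]⟩

theorem IsGorensteinProjective.prod {X Y : Type u} [AddCommGroup X] [Module A X]
    [AddCommGroup Y] [Module A Y] (hX : IsGorensteinProjective A X)
    (hY : IsGorensteinProjective A Y) : IsGorensteinProjective A (X × Y) := by
  let 𝒮 : Set (ModuleCat.{u} A) := {Z | ∃ X Y : ModuleCat.{u} A, IsGorensteinProjective A X ∧
    IsGorensteinProjective A Y ∧ Z = ModuleCat.of A (X × Y)}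
  refine of_mem_class (𝒮 := 𝒮) (X := ModuleCat.of A (X × Y)) ?_ ?_
    ⟨ModuleCat.of A X, ModuleCat.of A Y, hX, hY, rfl⟩
  · rintro _ ⟨X, Y, hX, hY, rfl⟩
    obtain ⟨X', hX', hXX'⟩ := (exists_isHomExactStep hX).1
    obtain ⟨Y', hY', hYY'⟩ := (exists_isHomExactStep hY).1
    exact ⟨_, ⟨X', Y', hX', hY', rfl⟩, hXX'.prod hYY'⟩
  · rintro _ ⟨X, Y, hX, hY, rfl⟩
    obtain ⟨X', hX', hXX'⟩ := (exists_isHomExactStep hX).2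
    obtain ⟨Y', hY', hYY'⟩ := (exists_isHomExactStep hY).2
    exact ⟨_, ⟨X', Y', hX', hY', rfl⟩, hXX'.prod hYY'⟩

theorem IsGorensteinProjective.pi : ∀ {n : ℕ} (X : Fin n → Type u) [∀ i, AddCommGroup (X i)]
    [∀ i, Module A (X i)], (∀ i, IsGorensteinProjective A (X i)) →
    IsGorensteinProjective A (∀ i, X i)
  | 0, X, _, _, _ => by
    have : Module.Projective A (∀ i, X i) :=
      .of_equiv' (LinearEquiv.ofSubsingleton PUnit.{u + 1} (∀ i, X i))
    exact of_projective _
  | n + 1, X, _, _, h =>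
    ((h 0).prod (IsGorensteinProjective.pi (fun i : Fin n => X i.succ) fun i => h i.succ)).of_equiv
      (Fin.consLinearEquiv A X).symm

/-- The class of all `X` having a complement `Y` with `X × Y` Gorenstein-projective is stable under
steps. Given `0 → X × Y → P → C → 0`, the cokernel of `X → P` stays in the class because `P/X × P/Y
≅ P × C`. Given `0 → K → P → X × Y → 0`, the kernels `KX`, `KY` of the two components satisfy `KX ×
KY ≅ K × P`. -/
theorem IsGorensteinProjective.of_prod {X Y : Type u} [AddCommGroup X] [Module A X]
    [AddCommGroup Y] [Module A Y] (hXY : IsGorensteinProjective A (X × Y)) :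
    IsGorensteinProjective A X := by
  let 𝒮 : Set (ModuleCat.{u} A) := {X | ∃ Y : ModuleCat.{u} A, IsGorensteinProjective A (X × Y)}
  refine of_mem_class (𝒮 := 𝒮) (X := ModuleCat.of A X) ?_ ?_ ⟨ModuleCat.of A Y, hXY⟩
  · rintro X ⟨Y, hXY⟩
    obtain ⟨C, hC, P, i, p, hP, hP', hi, hip, hp, hQ⟩ :=
      (exists_isHomExactStep (X := ModuleCat.of A (X × Y)) hXY).1
    let i' : X × Y →ₗ[A] P := i
    have hi' : Function.Injective i' := hi
    have hip' : Function.Exact i' p := hip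
    let a : X →ₗ[A] P := i' ∘ₗ LinearMap.inl A X Y
    let b : Y →ₗ[A] P := i' ∘ₗ LinearMap.inr A X Y
    have hab : ∀ x y, i' (x, y) = a x + b y := fun x y => by
      simp [a, b, ← map_add]
    -- Extending the projection onto `X` to an endomorphism `π` of `P` yields the splitting of `P →
    -- P/X × P/Y`: `id - π` kills `X`, `π` kills `Y`, and they sum to `id`.
    obtain ⟨π, hπ⟩ := hQ P hP hP' (a ∘ₗ LinearMap.fst A X Y)
    have hπa : ∀ x, π (a x) = a x := fun x => by
      have := LinearMap.congr_fun hπ ((x, 0) : X × Y)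
      simpa [a] using this
    have hπb : ∀ y, π (b y) = 0 := fun y => by
      have := LinearMap.congr_fun hπ ((0, y) : X × Y)
      simpa [b] using this
    let W := (P ⧸ LinearMap.range a) × (P ⧸ LinearMap.range b)
    let Δ : P →ₗ[A] W := (LinearMap.range a).mkQ.prod (LinearMap.range b).mkQ
    let ρa : (P ⧸ LinearMap.range a) →ₗ[A] P := (LinearMap.range a).liftQ (LinearMap.id - π) (by
      rintro _ ⟨x, rfl⟩
      simp [hπa])
    let ρb : (P ⧸ LinearMap.range b) →ₗ[A] P := (LinearMap.range b).liftQ π (by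
      rintro _ ⟨x, rfl⟩
      simp [hπb])
    have hρ : (ρa.coprod ρb) ∘ₗ Δ = LinearMap.id := by
      ext x
      simp [Δ, ρa, ρb]
    let γa : (P ⧸ LinearMap.range a) →ₗ[A] C := (LinearMap.range a).liftQ p (by
      rintro _ ⟨x, rfl⟩
      exact (hip' _).2 ⟨_, rfl⟩)
    let γb : (P ⧸ LinearMap.range b) →ₗ[A] C := (LinearMap.range b).liftQ p (by
      rintro _ ⟨x, rfl⟩
      exact (hip' _).2 ⟨_, rfl⟩)
    let γ : W →ₗ[A] C := γa.coprod (-γb)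
    have hγs : Function.Surjective γ := fun c => by
      obtain ⟨x, rfl⟩ := hp c
      exact ⟨(Submodule.Quotient.mk x, 0), by
        change γa (Submodule.Quotient.mk x) + -γb 0 = p x
        simp [γa]⟩
    have hex : Function.Exact Δ γ := by
      rintro ⟨x, y⟩
      induction x using Submodule.Quotient.induction_on with | _ x
      induction y using Submodule.Quotient.induction_on with | _ y
      constructor
      · intro h
        have h1 : p (x - y) = 0 := by
          rw [map_sub, sub_eq_add_neg]
          exact h
        obtain ⟨⟨u, v⟩, huv⟩ := (hip' _).1 h1
        rw [hab] at huv
        refine ⟨x - a u, Prod.ext ?_ ?_⟩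
        · exact (Submodule.Quotient.eq _).2 ⟨-u, by simp⟩
        · refine (Submodule.Quotient.eq _).2 ⟨v, ?_⟩
          rw [sub_right_comm, ← huv]
          simp
      · rintro ⟨z, hz⟩
        rw [← hz]
        change p z + -(p z) = 0
        simp
    have hΔ : Function.Injective Δ := Function.LeftInverse.injective (g := ρa.coprod ρb)
      fun x => LinearMap.congr_fun hρ x
    refine ⟨ModuleCat.of A (P ⧸ LinearMap.range a), ⟨ModuleCat.of A (P ⧸ LinearMap.range b),
      ((IsGorensteinProjective.of_projective P).prod hC).of_equiv
        (hex.splitInjectiveEquiv hγs ⟨_, hρ⟩).1⟩,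
      P, a, (LinearMap.range a).mkQ, hP, hP', hi'.comp LinearMap.inl_injective,
      LinearMap.exact_map_mkQ_range a, Submodule.mkQ_surjective _, ?_⟩
    intro Q _ _ h1 h2 h
    obtain ⟨h', hh'⟩ := hQ Q h1 h2 (h ∘ₗ LinearMap.fst A X Y)
    refine ⟨h', LinearMap.ext fun x => ?_⟩
    have := LinearMap.congr_fun hh' ((x, 0) : X × Y)
    simpa [a] using this
  · rintro X ⟨Y, hXY⟩
    obtain ⟨K, hK, P, i, p', hP, hP', hi, hip, hp, hQ⟩ :=
      (exists_isHomExactStep (X := ModuleCat.of A (X × Y)) hXY).2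
    let p : P →ₗ[A] X × Y := p'
    have hps : Function.Surjective p := hp
    have hip' : Function.Exact i p := hip
    have hpi : ∀ x, p (i x) = 0 := fun x => (hip' _).2 ⟨x, rfl⟩
    let KX := LinearMap.ker (LinearMap.fst A X Y ∘ₗ p)
    let KY := LinearMap.ker (LinearMap.snd A X Y ∘ₗ p)
    let iX : K →ₗ[A] KX := i.codRestrict KX fun x => by simp [KX, hpi]
    let iY : K →ₗ[A] KY := i.codRestrict KY fun x => by simp [KY, hpi]
    let δ : K →ₗ[A] KX × KY := iX.prod (-iY)
    let σ : KX × KY →ₗ[A] P := KX.subtype.coprod KY.subtype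
    have hδ : Function.Injective δ := fun x y hxy =>
      hi (congrArg Subtype.val (Prod.mk.inj hxy).1)
    have hσ : Function.Surjective σ := fun v => by
      obtain ⟨u, hu⟩ := hps (0, (p v).2)
      refine ⟨(⟨u, by simp [KX, hu]⟩, ⟨v - u, by simp [KY, hu]⟩), ?_⟩
      simp [σ]
    have hex : Function.Exact δ σ := by
      rintro ⟨⟨x, hx⟩, ⟨y, hy⟩⟩
      constructor
      · intro h
        have hyx : y = -x := eq_neg_of_add_eq_zero_right (by simpa [σ] using h)
        subst hyx
        obtain ⟨z, rfl⟩ := (hip' x).1 (Prod.ext hx (by simpa [KY] using hy))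
        exact ⟨z, rfl⟩
      · rintro ⟨z, hz⟩
        rw [← hz]
        change i z + -(i z) = 0
        simp
    obtain ⟨l, hl⟩ := Module.projective_lifting_property σ LinearMap.id hσ
    refine ⟨ModuleCat.of A KX, ⟨ModuleCat.of A KY,
      (hK.prod (IsGorensteinProjective.of_projective P)).of_equiv
        (hex.splitSurjectiveEquiv hδ ⟨l, hl⟩).1⟩,
      P, KX.subtype, LinearMap.fst A X Y ∘ₗ p, hP, hP', Subtype.val_injective,
      LinearMap.exact_subtype_ker_map _, Prod.fst_surjective.comp hps, ?_⟩
    intro Q _ _ h1 h2 (h : KX →ₗ[A] Q)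
    -- `ψ` extends `h` only from `K`. The defect `h - ψ` on `KX` kills `K`, so it factors through
    -- `KX/K ≅ Y`; the map `η` so obtained corrects `ψ`.
    obtain ⟨ψ, hψ⟩ := hQ Q h1 h2 (h ∘ₗ iX)
    let q : KX →ₗ[A] Y := LinearMap.snd A X Y ∘ₗ p ∘ₗ KX.subtype
    have hq : Function.Surjective q := fun y => by
      obtain ⟨u, hu⟩ := hps (0, y)
      exact ⟨⟨u, by simp [KX, hu]⟩, by simp [q, hu]⟩
    have hker : LinearMap.ker q ≤ LinearMap.ker (h - ψ ∘ₗ KX.subtype) := by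
      rintro ⟨x, hx⟩ hx'
      obtain ⟨z, rfl⟩ := (hip' x).1 (Prod.ext hx (by simpa [q] using hx'))
      have := LinearMap.congr_fun hψ z
      simp only [LinearMap.comp_apply] at this
      rw [LinearMap.mem_ker, LinearMap.sub_apply, LinearMap.comp_apply, Submodule.subtype_apply,
        this, sub_eq_zero]
      rfl
    let η : Y →ₗ[A] Q := (LinearMap.ker q).liftQ _ hker ∘ₗ
      (q.quotKerEquivOfSurjective hq).symm.toLinearMap
    refine ⟨ψ + η ∘ₗ LinearMap.snd A X Y ∘ₗ p, LinearMap.ext fun x => ?_⟩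
    have : η (q x) = h x - ψ x := by
      simp [η, LinearMap.quotKerEquivOfSurjective_symm_apply]
    change ψ x + η (q x) = h x
    rw [this]
    abel

end Closure

end GorensteinSilting

namespace GorensteinSilting

/-! ### Gorenstein-projectives as summands of powers of `E`. -/

section Summands

variable {A : Type u} [Ring A]

/-- `G` is a direct summand of a finite direct sum of copies of `E`. -/
def IsFinSummand (A : Type u) [Ring A] (E G : Type u) [AddCommGroup E] [Module A E]
    [AddCommGroup G] [Module A G] : Prop :=
  ∃ (ι : Type) (_ : Fintype ι) (r : ι → E →ₗ[A] G) (i : ι → G →ₗ[A] E),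
    ∑ j, r j ∘ₗ i j = LinearMap.id

variable {E G H : Type u} [AddCommGroup E] [Module A E] [AddCommGroup G] [Module A G]
  [AddCommGroup H] [Module A H]

theorem IsFinSummand.of_retract (h : IsFinSummand A E G) (s : H →ₗ[A] G) (t : G →ₗ[A] H)
    (hts : t ∘ₗ s = LinearMap.id) : IsFinSummand A E H := by
  obtain ⟨ι, _, r, i, hri⟩ := h
  refine ⟨ι, ‹_›, fun j => t ∘ₗ r j, fun j => i j ∘ₗ s, LinearMap.ext fun x => ?_⟩
  have h1 := congrArg t (LinearMap.congr_fun hri (s x))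
  have h2 := LinearMap.congr_fun hts x
  simp only [LinearMap.sum_apply, map_sum, LinearMap.comp_apply, LinearMap.id_apply] at h1 h2 ⊢
  rw [h1, h2]

theorem IsFinSummand.self : IsFinSummand A E E :=
  ⟨Unit, inferInstance, fun _ => LinearMap.id, fun _ => LinearMap.id, by simp⟩

theorem IsFinSummand.of_subsingleton [Subsingleton G] : IsFinSummand A E G :=
  ⟨Empty, inferInstance, Empty.elim, Empty.elim, Subsingleton.elim _ _⟩

theorem IsFinSummand.of_isCompl {p q : Submodule A G} (hpq : IsCompl p q)
    (hp : IsFinSummand A E p) (hq : IsFinSummand A E q) : IsFinSummand A E G := by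
  obtain ⟨ι, _, r, i, hri⟩ := hp
  obtain ⟨κ, _, s, j, hsj⟩ := hq
  refine ⟨ι ⊕ κ, inferInstance, Sum.elim (fun a => p.subtype ∘ₗ r a) (fun b => q.subtype ∘ₗ s b),
    Sum.elim (fun a => i a ∘ₗ p.projectionOnto q hpq)
      (fun b => j b ∘ₗ q.projectionOnto p hpq.symm), LinearMap.ext fun x => ?_⟩
  have h1 := congrArg p.subtype (LinearMap.congr_fun hri (p.projectionOnto q hpq x))
  have h2 := congrArg q.subtype (LinearMap.congr_fun hsj (q.projectionOnto p hpq.symm x))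
  simp only [LinearMap.sum_apply, map_sum, LinearMap.comp_apply, LinearMap.id_apply,
    Fintype.sum_sum_type, Sum.elim_inl, Sum.elim_inr, LinearMap.add_apply] at h1 h2 ⊢
  rw [h1, h2]
  exact Submodule.projection_add_projection_eq_self hpq x

theorem IsGorensteinProjective.of_retract (h : IsGorensteinProjective A G) (s : H →ₗ[A] G)
    (t : G →ₗ[A] H) (hts : t ∘ₗ s = LinearMap.id) : IsGorensteinProjective A H := by
  have hs : Function.Injective s :=
    Function.LeftInverse.injective (g := t) fun x => LinearMap.congr_fun hts x
  exact .of_prod (h.of_equiv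
    ((LinearMap.exact_map_mkQ_range s).splitInjectiveEquiv (Submodule.mkQ_surjective _)
      ⟨t, hts⟩).1.symm)

theorem IsGorensteinProjective.of_isFinSummand (hE : IsGorensteinProjective A E)
    (h : IsFinSummand A E G) : IsGorensteinProjective A G := by
  obtain ⟨ι, _, r, i, hri⟩ := h
  let e := Fintype.equivFin ι
  refine (IsGorensteinProjective.pi (fun _ : Fin (Fintype.card ι) => E) fun _ => hE).of_retract
    (LinearMap.pi fun j => i (e.symm j))
    (∑ j, r (e.symm j) ∘ₗ LinearMap.proj j) (LinearMap.ext fun x => ?_)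
  have h1 := LinearMap.congr_fun hri x
  simp only [LinearMap.sum_apply, LinearMap.comp_apply, LinearMap.id_apply, LinearMap.proj_apply,
    LinearMap.pi_apply] at h1 ⊢
  refine Eq.trans ?_ h1
  exact Equiv.sum_comp e.symm fun j => r j (i j x)

theorem IsFinSummand.of_equiv_pi {n : ℕ} {X : Fin n → Type u} [∀ i, AddCommGroup (X i)]
    [∀ i, Module A (X i)] (e : E ≃ₗ[A] ∀ i, X i) (j : Fin n) : IsFinSummand A E (X j) :=
  IsFinSummand.self.of_retract (e.symm.toLinearMap ∘ₗ LinearMap.single A X j)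
    (LinearMap.proj j ∘ₗ e.toLinearMap) (by ext x; simp)

/-- Induction on length: a decomposable module splits into two strictly shorter pieces, each
Gorenstein-projective as a retract. -/
theorem isFinSummand_of_isGorensteinProjective [IsArtinianRing A]
    (hE : IsGorensteinProjectiveGenerator A E) (hG : IsGorensteinProjective A G) :
    IsFinSummand A E G := by
  obtain ⟨n, X, -, -, hX, ⟨e⟩⟩ := hE
  have key : ∀ (l : ℕ∞) (G : ModuleCat.{u} A), Module.length A G = l →
      IsGorensteinProjective A G → IsFinSummand A E G := by
    intro l
    induction l using WellFoundedLT.induction with | _ l ih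
    rintro G rfl hG
    have := hG.1
    by_cases hi : IsIndecomposable A G
    · obtain ⟨j, ⟨e'⟩⟩ := hX G hG hi
      exact (IsFinSummand.of_equiv_pi e j).of_retract e'.toLinearMap e'.symm.toLinearMap
        (by ext x; simp)
    · rcases subsingleton_or_nontrivial G with hs | hn
      · exact .of_subsingleton
      · simp only [IsIndecomposable, hn, true_and, not_forall, not_or] at hi
        obtain ⟨p, q, hpq, hp, hq⟩ := hi
        have aux : ∀ p q : Submodule A G, IsCompl p q → q ≠ ⊥ → IsFinSummand A E p := by
          intro p q hpq hq
          refine ih _ (Submodule.length_lt (N := p) ?_) (ModuleCat.of A p) rfl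
            (hG.of_retract p.subtype (p.projectionOnto q hpq) (by ext x; simp))
          rintro rfl
          exact hq (by simpa using hpq.disjoint)
        exact .of_isCompl hpq (aux p q hpq hq) (aux q p hpq.symm hp)
  exact key _ (ModuleCat.of A G) rfl hG

theorem IsGorensteinProjectiveGenerator.isGorensteinProjective
    (hE : IsGorensteinProjectiveGenerator A E) : IsGorensteinProjective A E := by
  obtain ⟨n, X, h, -, -, ⟨e⟩⟩ := hE
  exact (IsGorensteinProjective.pi (fun i => X i) fun i => (h i).1).of_equiv e

theorem isGorensteinProjective_iff_isFinSummand [IsArtinianRing A]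
    (hE : IsGorensteinProjectiveGenerator A E) :
    IsGorensteinProjective A G ↔ IsFinSummand A E G :=
  ⟨isFinSummand_of_isGorensteinProjective hE, hE.isGorensteinProjective.of_isFinSummand⟩

end Summands

/-! ### Right minimal approximations and existence of minimal proper presentations. -/

section Approximations

variable {A : Type u} [Ring A] {E G M : Type u} [AddCommGroup E] [Module A E] [AddCommGroup G]
  [Module A G] [AddCommGroup M] [Module A M]

theorem IsFinSummand.comp_surjective {X Y : Type u} [AddCommGroup X] [Module A X]
    [AddCommGroup Y] [Module A Y] (hG : IsFinSummand A E G) {p : X →ₗ[A] Y}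
    (hp : ∀ h : E →ₗ[A] Y, ∃ h' : E →ₗ[A] X, p ∘ₗ h' = h) :
    Function.Surjective (fun h : G →ₗ[A] X => p ∘ₗ h) := by
  obtain ⟨ι, _, r, i, hri⟩ := hG
  intro h
  choose h' hh' using fun j => hp (h ∘ₗ r j)
  refine ⟨∑ j, h' j ∘ₗ i j, LinearMap.ext fun x => ?_⟩
  have h1 := congrArg h (LinearMap.congr_fun hri x)
  simp only [LinearMap.sum_apply, map_sum, LinearMap.comp_apply, LinearMap.id_apply] at h1 ⊢
  rw [← h1]
  exact Finset.sum_congr rfl fun j _ => LinearMap.congr_fun (hh' j) (i j x)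

/-- The underlying homomorphism of an element of `Hom_A(E, M)`. -/
def HomE.equiv (A E M : Type u) [Ring A] [AddCommGroup E] [Module A E] [AddCommGroup M]
    [Module A M] : HomE A E M ≃+ (E →ₗ[A] M) :=
  AddEquiv.refl _

@[simp]
theorem HomE.equiv_smul (s : CMAuslander A E) (h : HomE A E M) :
    HomE.equiv A E M (s • h) = HomE.equiv A E M h ∘ₗ s.unop := rfl

/-- Finitely many `Λ`-generators of `Hom_A(E, M)` assemble into an approximation `Eⁿ → M`. One whose
source has minimal length is right minimal, by Fitting's lemma. -/
theorem exists_isRightMinimal_approximation [IsArtinianRing A] [Module.Finite A E]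
    [Module.Finite (CMAuslander A E) (HomE A E M)] :
    ∃ (G : ModuleCat.{u} A) (g : G →ₗ[A] M), IsFinSummand A E G ∧
      (∀ h : E →ₗ[A] M, ∃ h' : E →ₗ[A] G, g ∘ₗ h' = h) ∧ IsRightMinimal g := by
  let 𝒞 : Set ℕ∞ := {l | ∃ (G : ModuleCat.{u} A) (g : G →ₗ[A] M), Module.length A G = l ∧
    Module.Finite A G ∧ IsFinSummand A E G ∧ ∀ h : E →ₗ[A] M, ∃ h' : E →ₗ[A] G, g ∘ₗ h' = h}
  have hne : 𝒞.Nonempty := by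
    obtain ⟨n, s, hs⟩ := Module.Finite.exists_fin (R := CMAuslander A E) (M := HomE A E M)
    refine ⟨_, ModuleCat.of A (Fin n → E),
      ∑ j, HomE.equiv A E M (s j) ∘ₗ LinearMap.proj j, rfl,
      inferInstanceAs (Module.Finite A (Fin n → E)), ?_, ?_⟩
    · refine ⟨Fin n, inferInstance, fun j => LinearMap.single A (fun _ => E) j,
        fun j => LinearMap.proj j, ?_⟩
      refine LinearMap.ext fun (x : Fin n → E) => funext fun l => ?_
      simp [LinearMap.sum_apply, Finset.sum_apply, Pi.single_apply]
    · intro h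
      have hh : (HomE.equiv A E M).symm h ∈ Submodule.span (CMAuslander A E) (Set.range s) := by
        rw [hs]; trivial
      obtain ⟨c, hc⟩ := (Submodule.mem_span_range_iff_exists_fun _).1 hh
      refine ⟨(LinearMap.pi fun j => (c j).unop : E →ₗ[A] Fin n → E), ?_⟩
      rw [← (HomE.equiv A E M).apply_symm_apply h, ← hc, map_sum]
      refine LinearMap.ext fun x => ?_
      simp [LinearMap.sum_apply]
  obtain ⟨G, g, hl, hfin, hG, hg⟩ := wellFounded_lt.min_mem 𝒞 hne
  refine ⟨G, g, hG, hg, fun e he => ?_⟩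
  have hpow : ∀ n : ℕ, g ∘ₗ (e ^ n : Module.End A G) = g := fun n => by
    induction n with
    | zero => rfl
    | succ n ih => rw [pow_succ]; exact (congrArg (· ∘ₗ e) ih).trans he
  -- Fitting: for large `n` the range of `e ^ n` is a summand of `G`. As `g ∘ e ^ n = g`, it still
  -- approximates `M`, so minimal length forces it to be all of `G`. The bound `1 ≤ n` lets
  -- surjectivity descend from `e ^ n` to `e`.
  obtain ⟨n, hn1, hn⟩ := ((LinearMap.eventually_isCompl_ker_pow_range_pow e).and
    (Filter.eventually_ge_atTop 1)).exists
  set W := LinearMap.range (e ^ n)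
  have hW : Module.length A W ∈ 𝒞 := by
    refine ⟨ModuleCat.of A W, g ∘ₗ W.subtype, rfl, inferInstanceAs (Module.Finite A W), ?_, ?_⟩
    · exact hG.of_retract W.subtype (W.projectionOnto _ hn1.symm) (by ext x; simp)
    · intro h
      obtain ⟨h', rfl⟩ := hg h
      refine ⟨(e ^ n : Module.End A G).rangeRestrict ∘ₗ h', ?_⟩
      conv_rhs => rw [← hpow n]
      rfl
  have htop : W = ⊤ := by
    by_contra hW'
    exact wellFounded_lt.not_lt_min 𝒞 hW (hl ▸ Submodule.length_lt hW')
  have hs : Function.Surjective e := by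
    obtain ⟨m, rfl⟩ : ∃ m, n = m + 1 := ⟨n - 1, by omega⟩
    have := LinearMap.range_eq_top.1 htop
    rw [pow_succ'] at this
    exact Function.Surjective.of_comp (g := (e ^ m : Module.End A G)) this
  exact IsNoetherian.bijective_of_surjective_endomorphism e hs

theorem IsRightMinimal.of_rangeRestrict {X Y : Type u} [AddCommGroup X] [Module A X]
    [AddCommGroup Y] [Module A Y] {f : X →ₗ[A] Y} (h : IsRightMinimal f.rangeRestrict) :
    IsRightMinimal f := fun e he =>
  h e (LinearMap.ext fun x => Subtype.ext (LinearMap.congr_fun he x))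

theorem exists_isMinimalProperPresentation [IsArtinianRing A]
    (hE : IsGorensteinProjectiveGenerator A E)
    (hfin : ∀ (N : Type u) [AddCommGroup N] [Module A N], Module.Finite A N →
      Module.Finite (CMAuslander A E) (HomE A E N)) [Module.Finite A M] :
    ∃ (G₁ G₀ : ModuleCat.{u} A) (f : G₁ →ₗ[A] G₀) (g : G₀ →ₗ[A] M),
      IsMinimalProperPresentation f g := by
  have hiff := fun {G : Type u} [AddCommGroup G] [Module A G] =>
    isGorensteinProjective_iff_isFinSummand (G := G) hE
  have := hE.isGorensteinProjective.1
  -- Maps out of `A` detect elements, and `A` is itself a summand of a power of `E`, so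
  -- approximations are onto.
  have surj : ∀ {X Y : Type u} [AddCommGroup X] [Module A X] [AddCommGroup Y] [Module A Y]
      {p : X →ₗ[A] Y}, (∀ h : E →ₗ[A] Y, ∃ h' : E →ₗ[A] X, p ∘ₗ h' = h) →
      Function.Surjective p := by
    intro X Y _ _ _ _ p hp y
    obtain ⟨h, hh⟩ := (hiff.1 (IsGorensteinProjective.of_projective A)).comp_surjective hp
      (LinearMap.toSpanSingleton A Y y)
    exact ⟨h 1, by simpa using LinearMap.congr_fun hh 1⟩
  have := hfin M inferInstance
  obtain ⟨G₀, g, hG₀, hg, hgmin⟩ := exists_isRightMinimal_approximation (A := A) (E := E) (M := M)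
  have := (hiff.2 hG₀).1
  have := hfin (LinearMap.ker g) inferInstance
  obtain ⟨G₁, c, hG₁, hc, hcmin⟩ :=
    exists_isRightMinimal_approximation (A := A) (E := E) (M := LinearMap.ker g)
  have hcs := surj hc
  have hex : Function.Exact ((LinearMap.ker g).subtype ∘ₗ c) g := by
    intro x
    constructor
    · intro hx
      obtain ⟨y, hy⟩ := hcs ⟨x, hx⟩
      exact ⟨y, congrArg Subtype.val hy⟩
    · rintro ⟨y, rfl⟩
      exact (c y).2
  refine ⟨G₁, G₀, (LinearMap.ker g).subtype ∘ₗ c, g,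
    ⟨⟨hiff.2 hG₁, hiff.2 hG₀, hex, surj hg, ?_, ?_⟩, ?_, hgmin⟩⟩
  · intro G _ _ hG h
    constructor
    · intro hh
      obtain ⟨h', hh'⟩ := (hiff.1 hG).comp_surjective hc
        (h.codRestrict (LinearMap.ker g) fun x => LinearMap.congr_fun hh x)
      exact ⟨h', LinearMap.ext fun x => congrArg Subtype.val (LinearMap.congr_fun hh' x)⟩
    · rintro ⟨h', rfl⟩
      exact LinearMap.ext fun x => (c (h' x)).2
  · intro G _ _ hG
    exact (hiff.1 hG).comp_surjective hg
  · intro e he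
    exact hcmin e (LinearMap.ext fun x =>
      Subtype.ext (congrArg (fun z => ((z : LinearMap.range _) : G₀)) (LinearMap.congr_fun he x)))

end Approximations

end GorensteinSilting

namespace GorensteinSilting

open MulOpposite

/-! ### Full faithfulness of `Hom_A(E, -)` on summands of powers of `E`. -/

section HomFunctor

variable {A : Type u} [Ring A] {E : Type u} [AddCommGroup E] [Module A E]
  {X Y Z G : Type u} [AddCommGroup X] [Module A X] [AddCommGroup Y] [Module A Y]
  [AddCommGroup Z] [Module A Z] [AddCommGroup G] [Module A G]

/-- `Hom_A(E, p) : Hom_A(E, X) → Hom_A(E, Y)`, as a map of `End_A(E)^op`-modules. -/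
def HomE.map (E : Type u) [AddCommGroup E] [Module A E] (p : X →ₗ[A] Y) :
    HomE A E X →ₗ[CMAuslander A E] HomE A E Y where
  toFun h := (HomE.equiv A E Y).symm (p ∘ₗ HomE.equiv A E X h)
  map_add' h h' := LinearMap.comp_add (HomE.equiv A E X h) (HomE.equiv A E X h') p
  map_smul' _ _ := rfl

@[simp]
theorem HomE.equiv_map (p : X →ₗ[A] Y) (h : HomE A E X) :
    HomE.equiv A E Y (HomE.map E p h) = p ∘ₗ HomE.equiv A E X h := rfl

theorem IsFinSummand.homE_map_injective (hG : IsFinSummand A E G) :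
    Function.Injective (fun p : G →ₗ[A] X => HomE.map E p) := by
  obtain ⟨ι, _, r, i, hri⟩ := hG
  intro p q (hpq : HomE.map E p = HomE.map E q)
  have h1 : ∀ j, p ∘ₗ r j = q ∘ₗ r j := fun j =>
    LinearMap.congr_fun hpq ((HomE.equiv A E G).symm (r j))
  rw [← LinearMap.comp_id p, ← LinearMap.comp_id q, ← hri]
  refine LinearMap.ext fun x => ?_
  simp only [LinearMap.comp_apply, LinearMap.sum_apply, map_sum]
  exact Finset.sum_congr rfl fun j _ => LinearMap.congr_fun (h1 j) (i j x)

/-- A dual basis: the `r j` generate `Hom_A(E, G)` with coordinates `i j ∘ m`. This drives both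
fullness and projectivity. -/
theorem HomE.eq_sum_smul {ι : Type} [Fintype ι] {r : ι → E →ₗ[A] G} {i : ι → G →ₗ[A] E}
    (hri : ∑ j, r j ∘ₗ i j = LinearMap.id) (m : HomE A E G) :
    m = ∑ j, (op (i j ∘ₗ HomE.equiv A E G m) : CMAuslander A E) •
      (HomE.equiv A E G).symm (r j) := by
  apply (HomE.equiv A E G).injective
  refine LinearMap.ext fun x => ?_
  have := LinearMap.congr_fun hri (HomE.equiv A E G m x)
  simp only [LinearMap.sum_apply, LinearMap.comp_apply, LinearMap.id_apply] at this
  simp [LinearMap.sum_apply, this]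

theorem IsFinSummand.homE_map_surjective (hG : IsFinSummand A E G) :
    Function.Surjective (fun p : G →ₗ[A] X => HomE.map E p) := by
  obtain ⟨ι, _, r, i, hri⟩ := hG
  intro φ
  refine ⟨∑ j, HomE.equiv A E X (φ ((HomE.equiv A E G).symm (r j))) ∘ₗ i j,
    LinearMap.ext fun m => ?_⟩
  conv_rhs => rw [HomE.eq_sum_smul hri m, map_sum]
  apply (HomE.equiv A E X).injective
  refine LinearMap.ext fun x => ?_
  simp [LinearMap.sum_apply]

theorem IsFinSummand.finite_projective_homE (hG : IsFinSummand A E G) :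
    Module.Finite (CMAuslander A E) (HomE A E G) ∧
      Module.Projective (CMAuslander A E) (HomE A E G) := by
  obtain ⟨ι, _, r, i, hri⟩ := hG
  let s : (ι → CMAuslander A E) →ₗ[CMAuslander A E] HomE A E G :=
    Fintype.linearCombination (CMAuslander A E) fun j => (HomE.equiv A E G).symm (r j)
  let t : HomE A E G →ₗ[CMAuslander A E] (ι → CMAuslander A E) :=
    { toFun := fun m j => op (i j ∘ₗ HomE.equiv A E G m)
      map_add' := fun m m' => funext fun j => by
        rw [map_add, LinearMap.comp_add]; rfl
      map_smul' := fun c m => rfl }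
  have hst : s ∘ₗ t = LinearMap.id := LinearMap.ext fun m => (HomE.eq_sum_smul hri m).symm
  exact ⟨.of_surjective s fun m => ⟨t m, LinearMap.congr_fun hst m⟩,
    .of_split t s hst⟩

theorem IsRightMinimal.homE_map (hG : IsFinSummand A E G) {f : G →ₗ[A] X}
    (hf : IsRightMinimal f) : IsRightMinimal (HomE.map E f) := by
  intro e he
  obtain ⟨e, rfl⟩ := hG.homE_map_surjective e
  have hb := hf e (hG.homE_map_injective he)
  let e' := LinearEquiv.ofBijective e hb
  refine ⟨fun m m' h => ?_, fun m => ?_⟩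
  · refine LinearMap.ext fun x => hb.1 (LinearMap.congr_fun (show e ∘ₗ m = e ∘ₗ m' from h) x)
  · exact ⟨(HomE.equiv A E G).symm (e'.symm.toLinearMap ∘ₗ HomE.equiv A E G m),
      LinearMap.ext fun x => e'.apply_symm_apply _⟩

end HomFunctor

/-! ### Projective covers: right minimality and uniqueness. -/

section ProjectiveCovers

variable {L : Type u} [Ring L] {P Q N P' Q' N' : Type u} [AddCommGroup P] [Module L P]
  [AddCommGroup Q] [Module L Q] [AddCommGroup N] [Module L N] [AddCommGroup P'] [Module L P']
  [AddCommGroup Q'] [Module L Q'] [AddCommGroup N'] [Module L N']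

/-- If `ker p + K` is everything, then `K` already maps onto the range. Lifting `p` through `K`
gives an endomorphism `e` with `p e = p` and image in `K`; it is bijective, so `K` is everything. -/
theorem IsRightMinimal.isProjectiveCover_rangeRestrict [Module.Finite L P] [Module.Projective L P]
    {p : P →ₗ[L] Q} (hp : IsRightMinimal p) : IsProjectiveCover p.rangeRestrict where
  finite := ‹_›
  projective := ‹_›
  surjective := p.surjective_rangeRestrict
  superfluous K hK := by
    have hs : Function.Surjective (p.rangeRestrict ∘ₗ K.subtype) := by
      intro y
      obtain ⟨x, rfl⟩ := p.surjective_rangeRestrict y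
      obtain ⟨a, ha, b, hb, rfl⟩ := Submodule.mem_sup.1 (hK ▸ Submodule.mem_top : x ∈ _ ⊔ K)
      exact ⟨⟨b, hb⟩, by rw [map_add, LinearMap.mem_ker.1 ha, zero_add]; rfl⟩
    obtain ⟨l, hl⟩ := Module.projective_lifting_property _ p.rangeRestrict hs
    have hb := hp (K.subtype ∘ₗ l) (LinearMap.ext fun x =>
      congrArg Subtype.val (LinearMap.congr_fun hl x))
    rw [eq_top_iff]
    intro x _
    obtain ⟨y, rfl⟩ := hb.2 x
    exact (l y).2

theorem IsRightMinimal.isProjectiveCover [Module.Finite L P] [Module.Projective L P]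
    {p : P →ₗ[L] Q} (hp : IsRightMinimal p) (hs : Function.Surjective p) :
    IsProjectiveCover p where
  finite := ‹_›
  projective := ‹_›
  surjective := hs
  superfluous K hK := hp.isProjectiveCover_rangeRestrict.superfluous K
    (by rwa [LinearMap.ker_rangeRestrict])

/-- A lift `a` of `p` through `p'` is onto because `ker p'` is superfluous. Its section is onto
because `ker p` is superfluous, so `a` is injective. -/
theorem IsProjectiveCover.exists_equiv {p : P →ₗ[L] N} {p' : P' →ₗ[L] N}
    (hp : IsProjectiveCover p) (hp' : IsProjectiveCover p') :
    ∃ e : P ≃ₗ[L] P', ∀ x, p' (e x) = p x := by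
  have := hp.projective
  have := hp'.projective
  obtain ⟨a, ha⟩ := Module.projective_lifting_property p' p hp'.surjective
  have ha' : ∀ x, p' (a x) = p x := LinearMap.congr_fun ha
  have has : Function.Surjective a := by
    rw [← LinearMap.range_eq_top]
    refine hp'.superfluous _ (eq_top_iff.2 fun x _ => ?_)
    obtain ⟨y, hy⟩ := hp.surjective (p' x)
    rw [← sub_add_cancel x (a y)]
    exact Submodule.add_mem_sup (by simp [ha', hy]) ⟨y, rfl⟩
  obtain ⟨s, hs⟩ := Module.projective_lifting_property a LinearMap.id has
  have hs' : ∀ x, a (s x) = x := LinearMap.congr_fun hs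
  have hss : LinearMap.range s = ⊤ := by
    refine hp.superfluous _ (eq_top_iff.2 fun x _ => ?_)
    rw [← sub_add_cancel x (s (a x))]
    exact Submodule.add_mem_sup (by simp [← ha', hs']) ⟨a x, rfl⟩
  have hai : Function.Injective a := by
    intro x y hxy
    obtain ⟨x, rfl⟩ := LinearMap.range_eq_top.1 hss x
    obtain ⟨y, rfl⟩ := LinearMap.range_eq_top.1 hss y
    rw [hs', hs'] at hxy
    rw [hxy]
  exact ⟨LinearEquiv.ofBijective a ⟨hai, has⟩, ha'⟩

theorem IsProjectiveCover.comp_equiv {p : P →ₗ[L] N} (hp : IsProjectiveCover p) (e : N ≃ₗ[L] N') :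
    IsProjectiveCover (e.toLinearMap ∘ₗ p) where
  finite := hp.finite
  projective := hp.projective
  surjective := e.surjective.comp hp.surjective
  superfluous K hK := hp.superfluous K (by rwa [LinearEquiv.ker_comp] at hK)

theorem IsMinimalProjectivePresentation.exists_equiv {p : P →ₗ[L] Q} {q : Q →ₗ[L] N}
    {p' : P' →ₗ[L] Q'} {q' : Q' →ₗ[L] N} (h : IsMinimalProjectivePresentation p q)
    (h' : IsMinimalProjectivePresentation p' q') :
    ∃ (e₁ : P ≃ₗ[L] P') (e₀ : Q ≃ₗ[L] Q'), ∀ x, p' (e₁ x) = e₀ (p x) := by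
  obtain ⟨e₀, he₀⟩ := h.cover₀.exists_equiv h'.cover₀
  have hmap : (LinearMap.range p).map e₀.toLinearMap = LinearMap.range p' := by
    ext y
    constructor
    · rintro ⟨_, ⟨x, rfl⟩, rfl⟩
      refine (h'.exact _).1 ?_
      rw [LinearEquiv.coe_coe, he₀]
      exact (h.exact _).2 ⟨x, rfl⟩
    · intro hy
      have hy' := (h'.exact y).2 hy
      obtain ⟨y, rfl⟩ := e₀.surjective y
      rw [he₀] at hy'
      exact ⟨y, (h.exact _).1 hy', rfl⟩
  obtain ⟨e₁, he₁⟩ := (h.cover₁.comp_equiv (e₀.ofSubmodules _ _ hmap)).exists_equiv h'.cover₁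
  exact ⟨e₁, e₀, fun x => congrArg Subtype.val (he₁ x)⟩

end ProjectiveCovers

/-! ### Minimal proper presentations become minimal projective presentations. -/

section HomPresentation

variable {A : Type u} [Ring A] {E G₁ G₀ M : Type u} [AddCommGroup E] [Module A E]
  [AddCommGroup G₁] [Module A G₁] [AddCommGroup G₀] [Module A G₀] [AddCommGroup M] [Module A M]

theorem IsMinimalProperPresentation.homE_map [IsArtinianRing A]
    (hE : IsGorensteinProjectiveGenerator A E) {f : G₁ →ₗ[A] G₀} {g : G₀ →ₗ[A] M}
    (h : IsMinimalProperPresentation f g) :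
    IsMinimalProjectivePresentation (HomE.map E f) (HomE.map E g) := by
  have h1 := isFinSummand_of_isGorensteinProjective hE h.gproj₁
  have h0 := isFinSummand_of_isGorensteinProjective hE h.gproj₀
  obtain ⟨_, _⟩ := h1.finite_projective_homE
  obtain ⟨_, _⟩ := h0.finite_projective_homE
  exact ⟨h.hom_exact E hE.isGorensteinProjective,
    (h.minimal₁.of_rangeRestrict.homE_map h1).isProjectiveCover_rangeRestrict,
    (h.minimal₀.homE_map h0).isProjectiveCover (h.hom_surjective E hE.isGorensteinProjective)⟩

end HomPresentation

/-! ### Comparison of `τ_G M` with `τ Hom_A(E, M)`. -/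

section TranslateEquiv

theorem nonempty_ker_equiv {L V₁ V₀ W₁ W₀ : Type*} [Ring L] [AddCommGroup V₁] [Module L V₁]
    [AddCommGroup V₀] [Module L V₀] [AddCommGroup W₁] [Module L W₁] [AddCommGroup W₀] [Module L W₀]
    {d : V₁ →ₗ[L] V₀} {d' : W₁ →ₗ[L] W₀} (e₁ : V₁ ≃ₗ[L] W₁) (e₀ : V₀ ≃ₗ[L] W₀)
    (h : ∀ x, d' (e₁ x) = e₀ (d x)) :
    Nonempty (LinearMap.ker d ≃ₗ[L] LinearMap.ker d') := by
  refine ⟨e₁.ofSubmodules _ _ (Submodule.ext fun y => ?_)⟩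
  constructor
  · rintro ⟨x, hx, rfl⟩
    rw [LinearMap.mem_ker, LinearEquiv.coe_coe, h, LinearMap.mem_ker.1 hx, map_zero]
  · intro hy
    obtain ⟨x, rfl⟩ := e₁.surjective y
    exact ⟨x, by simpa [h] using hy, rfl⟩

section

variable (k L A E : Type u) [Field k] [Ring L] [Ring A] [AddCommGroup E] [Module A E] [Module k E]
  [SMulCommClass A k E] [Module Lᵐᵒᵖ E] [SMulCommClass A Lᵐᵒᵖ E] [SMulCommClass Lᵐᵒᵖ k E]

/-- An isomorphism `G ≅ G'` induces `D Hom_A(G, E) ≅ D Hom_A(G', E)`. -/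
def dualHomEquiv {G G' : Type u} [AddCommGroup G] [Module A G] [AddCommGroup G'] [Module A G']
    (e : G ≃ₗ[A] G') : DualHom k A E G ≃ₗ[L] DualHom k A E G' :=
  LinearEquiv.ofLinearMap (dualHomMap k L A E e.toLinearMap) (dualHomMap k L A E e.symm.toLinearMap)
    (LinearMap.ext fun φ => LinearMap.ext (R := k) (M := G' →ₗ[A] E) (M₃ := k) fun h =>
      congrArg (DFunLike.coe (F := Module.Dual k (G' →ₗ[A] E)) φ)
        (LinearMap.ext fun x => congrArg h (e.apply_symm_apply x)))
    (LinearMap.ext fun φ => LinearMap.ext (R := k) (M := G →ₗ[A] E) (M₃ := k) fun h =>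
      congrArg (DFunLike.coe (F := Module.Dual k (G →ₗ[A] E)) φ)
        (LinearMap.ext fun x => congrArg h (e.symm_apply_apply x)))

theorem nonempty_translate_equiv {P Q P' Q' : Type u} [AddCommGroup P] [Module A P]
    [AddCommGroup Q] [Module A Q] [AddCommGroup P'] [Module A P'] [AddCommGroup Q'] [Module A Q']
    {p : P →ₗ[A] Q} {p' : P' →ₗ[A] Q'} (e₁ : P ≃ₗ[A] P') (e₀ : Q ≃ₗ[A] Q')
    (h : ∀ x, p' (e₁ x) = e₀ (p x)) :
    Nonempty (translate k L A E p ≃ₗ[L] translate k L A E p') :=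
  nonempty_ker_equiv (dualHomEquiv k L A E e₁) (dualHomEquiv k L A E e₀) fun φ =>
    LinearMap.ext (R := k) (M := Q' →ₗ[A] E) (M₃ := k) fun u =>
      congrArg (DFunLike.coe (F := Module.Dual k (P →ₗ[A] E)) φ)
        (LinearMap.ext fun x => congrArg u (h x))

variable {k L A E} in
/-- An isomorphism `Hom_A(G, E) ≅ Hom_L(P, L)` of right `L`-modules induces
`D Hom_L(P, L) ≅ D Hom_A(G, E)`. -/
def dualHomEquivOfHomEquiv [Algebra k L] {P G : Type u} [AddCommGroup P] [Module L P]
    [AddCommGroup G] [Module A G] (α : (G →ₗ[A] E) ≃ₗ[k] (P →ₗ[L] L))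
    (hα : ∀ (l : L) (u : G →ₗ[A] E) (x : P), α (op l • u) x = α u x * l) :
    DualHom k L L P ≃ₗ[L] DualHom k A E G where
  toFun φ := LinearMap.comp (φ : Module.Dual k (P →ₗ[L] L)) α.toLinearMap
  invFun φ := LinearMap.comp (φ : Module.Dual k (G →ₗ[A] E)) α.symm.toLinearMap
  map_add' _ _ := LinearMap.add_comp _ _ _
  map_smul' l φ := LinearMap.ext (R := k) (M := G →ₗ[A] E) (M₃ := k) fun u =>
    congrArg (DFunLike.coe (F := Module.Dual k (P →ₗ[L] L)) φ)
      (LinearMap.ext fun x => (hα l u x).symm)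
  left_inv φ := LinearMap.ext (R := k) (M := P →ₗ[L] L) (M₃ := k) fun u =>
    congrArg (DFunLike.coe (F := Module.Dual k (P →ₗ[L] L)) φ) (α.apply_symm_apply u)
  right_inv φ := LinearMap.ext (R := k) (M := G →ₗ[A] E) (M₃ := k) fun u =>
    congrArg (DFunLike.coe (F := Module.Dual k (G →ₗ[A] E)) φ) (α.symm_apply_apply u)

variable {k L A E} in
-- `h₁` and `h₀` express right `L`-linearity, which makes the dual isomorphisms left `L`-linear; `h`
-- makes them commute with the maps whose kernels are compared.
theorem nonempty_tau_equiv_translate [Algebra k L] {P₁ P₀ G₁ G₀ : Type u} [AddCommGroup P₁]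
    [Module L P₁] [AddCommGroup P₀] [Module L P₀] [AddCommGroup G₁] [Module A G₁]
    [AddCommGroup G₀] [Module A G₀] {p : P₁ →ₗ[L] P₀} {f : G₁ →ₗ[A] G₀}
    (α₁ : (G₁ →ₗ[A] E) ≃ₗ[k] (P₁ →ₗ[L] L)) (α₀ : (G₀ →ₗ[A] E) ≃ₗ[k] (P₀ →ₗ[L] L))
    (h₁ : ∀ (l : L) (u : G₁ →ₗ[A] E) (x : P₁), α₁ (op l • u) x = α₁ u x * l)
    (h₀ : ∀ (l : L) (u : G₀ →ₗ[A] E) (x : P₀), α₀ (op l • u) x = α₀ u x * l)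
    (h : ∀ u : G₀ →ₗ[A] E, α₁ (u ∘ₗ f) = α₀ u ∘ₗ p) :
    Nonempty (tau k L p ≃ₗ[L] translate k L A E f) :=
  nonempty_ker_equiv (dualHomEquivOfHomEquiv α₁ h₁) (dualHomEquivOfHomEquiv α₀ h₀) fun φ =>
    LinearMap.ext (R := k) (M := G₀ →ₗ[A] E) (M₃ := k) fun u =>
      congrArg (DFunLike.coe (F := Module.Dual k (P₁ →ₗ[L] L)) φ) (h u)

variable {L} in
theorem nonempty_tau_equiv_tau [Algebra k L] {P Q P' Q' : Type u} [AddCommGroup P] [Module L P]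
    [AddCommGroup Q] [Module L Q] [AddCommGroup P'] [Module L P'] [AddCommGroup Q'] [Module L Q']
    {p : P →ₗ[L] Q} {p' : P' →ₗ[L] Q'} (e₁ : P ≃ₗ[L] P') (e₀ : Q ≃ₗ[L] Q')
    (h : ∀ x, p' (e₁ x) = e₀ (p x)) : Nonempty (tau k L p ≃ₗ[L] tau k L p') :=
  nonempty_translate_equiv k L L L e₁ e₀ h

end

variable {k A E : Type u} [Field k] [Ring A] [Algebra k A] [AddCommGroup E] [Module A E]
  [Module k E] [IsScalarTower k A E] {G : Type u} [AddCommGroup G] [Module A G]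

variable (k E) in
/-- `Hom_A(G, E) → Hom_Λ(Hom_A(E, G), Λ)` for `Λ = End_A(E)^op`, induced by `Hom_A(E, -)`. -/
def homToHomE (G : Type u) [AddCommGroup G] [Module A G] :
    (G →ₗ[A] E) →ₗ[k] (HomE A E G →ₗ[CMAuslander A E] CMAuslander A E) where
  toFun u :=
    { toFun := fun m => op (u ∘ₗ HomE.equiv A E G m)
      map_add' := fun m m' => by rw [map_add, LinearMap.comp_add]; rfl
      map_smul' := fun _ _ => rfl }
  map_add' _ _ := rfl
  map_smul' _ _ := rfl

variable (k) in
-- As a left module `Λ` is `Hom_A(E, E)`, so this is full faithfulness with target `E`.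
theorem IsFinSummand.homToHomE_bijective (hG : IsFinSummand A E G) :
    Function.Bijective (homToHomE (A := A) k E G) := by
  refine ⟨fun u v huv => ?_, fun φ => ?_⟩
  · exact hG.homE_map_injective (LinearMap.ext fun m =>
      congrArg unop (LinearMap.congr_fun huv m))
  · obtain ⟨u, hu⟩ := hG.homE_map_surjective (X := E)
      { toFun := fun m => (HomE.equiv A E E).symm (unop (φ m))
        map_add' := fun m m' => by rw [map_add]; rfl
        map_smul' := fun c m => by rw [map_smul]; rfl }
    exact ⟨u, LinearMap.ext fun m => congrArg op (LinearMap.congr_fun hu m)⟩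

theorem nonempty_tau_homE_equiv_tauG {G₁ G₀ : Type u} [AddCommGroup G₁] [Module A G₁]
    [AddCommGroup G₀] [Module A G₀] (h₁ : IsFinSummand A E G₁) (h₀ : IsFinSummand A E G₀)
    (f : G₁ →ₗ[A] G₀) :
    Nonempty (tau k (CMAuslander A E) (HomE.map E f) ≃ₗ[CMAuslander A E] tauG k A E f) :=
  nonempty_tau_equiv_translate
    (.ofBijective (homToHomE k E G₁) (h₁.homToHomE_bijective k))
    (.ofBijective (homToHomE k E G₀) (h₀.homToHomE_bijective k))
    (fun _ _ _ => rfl) (fun _ _ _ => rfl) fun _ => rfl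

theorem IsMinimalProperPresentation.nonempty_tauG_equiv_tau [IsArtinianRing A]
    (hE : IsGorensteinProjectiveGenerator A E) {G₁ G₀ M : Type u}
    [AddCommGroup G₁] [Module A G₁] [AddCommGroup G₀] [Module A G₀] [AddCommGroup M] [Module A M]
    {f : G₁ →ₗ[A] G₀} {g : G₀ →ₗ[A] M} (h : IsMinimalProperPresentation f g)
    {P₁ P₀ : Type u} [AddCommGroup P₁] [Module (CMAuslander A E) P₁]
    [AddCommGroup P₀] [Module (CMAuslander A E) P₀]
    {p : P₁ →ₗ[CMAuslander A E] P₀} {q : P₀ →ₗ[CMAuslander A E] HomE A E M}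
    (hpq : IsMinimalProjectivePresentation p q) :
    Nonempty (tauG k A E f ≃ₗ[CMAuslander A E] tau k (CMAuslander A E) p) := by
  obtain ⟨e₁, e₀, he⟩ := (h.homE_map hE).exists_equiv hpq
  obtain ⟨a⟩ := nonempty_tau_equiv_tau k e₁ e₀ he
  obtain ⟨b⟩ := nonempty_tau_homE_equiv_tauG (k := k)
    (isFinSummand_of_isGorensteinProjective hE h.gproj₁)
    (isFinSummand_of_isGorensteinProjective hE h.gproj₀) f
  exact ⟨b.symm.trans a⟩

end TranslateEquiv

end GorensteinSilting

namespace GorensteinSilting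

open MulOpposite

/-! ### Finite generation of `Hom_A(E, N)` over `Λ`. -/

section Finiteness

/-- The space is finite-dimensional over `k`, and `k` acts through the elements `c • id` of `Λ`, so
a spanning set over `k` generates over `Λ`. -/
theorem finite_homE (k : Type u) {A : Type u} [Field k] [Ring A] [Algebra k A]
    [FiniteDimensional k A] {E : Type u} [AddCommGroup E] [Module A E] [Module k E]
    [IsScalarTower k A E] [Module.Finite A E] (N : Type u) [AddCommGroup N] [Module A N]
    [Module.Finite A N] : Module.Finite (CMAuslander A E) (HomE A E N) := by
  let _ : Module k N := Module.compHom N (algebraMap k A)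
  have : IsScalarTower k A N := ⟨fun c a x => by
    rw [Algebra.smul_def, mul_smul]; rfl⟩
  have : Module.Finite k N := Module.Finite.trans A N
  have : Module.Finite k E := Module.Finite.trans A E
  have : Module.Finite k (E →ₗ[A] N) :=
    Module.Finite.of_injective (LinearMap.restrictScalarsₗ k A E N k)
      (LinearMap.restrictScalars_injective k)
  obtain ⟨t, ht⟩ := Module.Finite.fg_top (R := k) (M := E →ₗ[A] N)
  classical
  refine ⟨⟨t.image (HomE.equiv A E N).symm, eq_top_iff.2 fun m _ => ?_⟩⟩
  have hm : HomE.equiv A E N m ∈ Submodule.span k (t : Set (E →ₗ[A] N)) := ht ▸ Submodule.mem_top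
  have key : ∀ h ∈ Submodule.span k (t : Set (E →ₗ[A] N)), (HomE.equiv A E N).symm h ∈
      Submodule.span (CMAuslander A E)
        ((t.image (HomE.equiv A E N).symm : Finset (HomE A E N)) : Set (HomE A E N)) := by
    intro h hh
    induction hh using Submodule.span_induction with
    | mem x hx => exact Submodule.subset_span (by simpa using hx)
    | zero => rw [map_zero]; exact zero_mem _
    | add x y _ _ hx hy => rw [map_add]; exact add_mem hx hy
    | smul c x _ hx =>
      have : (HomE.equiv A E N).symm (c • x) =
          (op (c • LinearMap.id) : CMAuslander A E) • (HomE.equiv A E N).symm x := by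
        refine LinearMap.ext fun y => ?_
        exact (x.map_smul_of_tower c y).symm
      rw [this]
      exact Submodule.smul_mem _ _ hx
  exact key _ hm

end Finiteness

/-! ### The duality between maps into the translate and the cokernel of `Hom_A(θ, M)`. -/

section HomTranslate

variable {k A : Type u} [Field k] [Ring A] [Algebra k A]
  {E : Type u} [AddCommGroup E] [Module A E] [Module k E] [IsScalarTower k A E]
  {G₁ G₀ M : Type u} [AddCommGroup G₁] [Module A G₁] [AddCommGroup G₀] [Module A G₀]
  [AddCommGroup M] [Module A M]

/-- The value of an element of `D Hom_A(G, E)` on a homomorphism. -/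
def DualHom.eval {G : Type u} [AddCommGroup G] [Module A G] (φ : DualHom k A E G) :
    Module.Dual k (G →ₗ[A] E) := φ

/-- `φ` amounts to a pairing `Φ m u`, balanced over `End_A(E)` and zero on every `v ∘ θ`. It comes
from a functional `ψ` on `Hom_A(G₁, M)` with `ψ (m ∘ u) = Φ m u`, and `ψ` vanishes on the image of
`Hom_A(θ, M)`. -/
theorem eq_zero_of_surjective_precomp (h₁ : IsFinSummand A E G₁) (h₀ : IsFinSummand A E G₀)
    {θ : G₁ →ₗ[A] G₀} (hθ : Function.Surjective (fun h : G₀ →ₗ[A] M => h ∘ₗ θ))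
    (φ : HomE A E M →ₗ[CMAuslander A E] tauG k A E θ) : φ = 0 := by
  obtain ⟨ι, _, r, i, hri⟩ := h₁
  obtain ⟨κ, _, s, t, hst⟩ := h₀
  let Φ : (E →ₗ[A] M) → (G₁ →ₗ[A] E) → k := fun m u =>
    DualHom.eval (φ ((HomE.equiv A E M).symm m) : DualHom k A E G₁) u
  have Φ_add : ∀ m m' u, Φ (m + m') u = Φ m u + Φ m' u := fun m m' u => by
    simp only [Φ, map_add]
    rfl
  have Φ_sum : ∀ {β : Type} [Fintype β] (m : β → E →ₗ[A] M) (u : G₁ →ₗ[A] E),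
      Φ (∑ b, m b) u = ∑ b, Φ (m b) u := fun m u =>
    map_sum (AddMonoidHom.mk' (fun m => Φ m u) fun m m' => Φ_add m m' u) m Finset.univ
  have Φ_comp : ∀ m (e : E →ₗ[A] E) u, Φ (m ∘ₗ e) u = Φ m (e ∘ₗ u) := fun m e u => by
    have h1 : (HomE.equiv A E M).symm (m ∘ₗ e) =
      (op e : CMAuslander A E) • (HomE.equiv A E M).symm m := rfl
    simp only [Φ, h1, map_smul]
    rfl
  have Φ_ker : ∀ m (v : G₀ →ₗ[A] E), Φ m (v ∘ₗ θ) = 0 := fun m v =>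
    congrArg (fun ψ => DualHom.eval (ψ : DualHom k A E G₀) v)
      (LinearMap.mem_ker.1 (φ ((HomE.equiv A E M).symm m)).2)
  -- Forced by `h = ∑ (h ∘ r j) ∘ i j`; balancedness of `Φ` gives `ψ (m ∘ u) = Φ m u`.
  let ψ : (G₁ →ₗ[A] M) → k := fun h => ∑ j, Φ (h ∘ₗ r j) (i j)
  have hψ : ∀ m u, ψ (m ∘ₗ u) = Φ m u := fun m u => by
    have h1 : ∑ j, (u ∘ₗ r j) ∘ₗ i j = u := by
      conv_rhs => rw [← LinearMap.comp_id u, ← hri]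
      refine LinearMap.ext fun x => ?_
      simp [LinearMap.sum_apply]
    conv_rhs => rw [← h1]
    have h2 : ∀ j, Φ ((m ∘ₗ u) ∘ₗ r j) (i j) = Φ m ((u ∘ₗ r j) ∘ₗ i j) := fun j =>
      Φ_comp m (u ∘ₗ r j) (i j)
    simp only [ψ, h2]
    exact (map_sum (DualHom.eval (φ ((HomE.equiv A E M).symm m) : DualHom k A E G₁)) _ _).symm
  have ψ_sum : ∀ {β : Type} [Fintype β] (h : β → G₁ →ₗ[A] M), ψ (∑ b, h b) = ∑ b, ψ (h b) := by
    intro β _ h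
    simp only [ψ]
    rw [Finset.sum_comm]
    refine Finset.sum_congr rfl fun j _ => ?_
    rw [← Φ_sum]
    congr 1
    exact LinearMap.ext fun x => by simp [LinearMap.sum_apply]
  have hz : ∀ h, ψ h = 0 := by
    intro h
    obtain ⟨h', rfl⟩ := hθ h
    -- `Φ_ker` only concerns maps factoring through `E`, so `h'` is split along the decomposition of
    -- `G₀`.
    have h1 : h' ∘ₗ θ = ∑ l, (h' ∘ₗ s l) ∘ₗ (t l ∘ₗ θ) := by
      refine LinearMap.ext fun x => ?_
      have := congrArg h' (LinearMap.congr_fun hst (θ x))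
      simpa [LinearMap.sum_apply] using this.symm
    change ψ (h' ∘ₗ θ) = 0
    rw [h1, ψ_sum]
    exact Finset.sum_eq_zero fun l _ => by rw [hψ, Φ_ker]
  refine LinearMap.ext fun m => Subtype.ext ?_
  refine LinearMap.ext (R := k) (M := G₁ →ₗ[A] E) (M₃ := k) fun u => ?_
  exact (hψ (HomE.equiv A E M m) u).symm.trans (hz _)

/-- If `Hom_A(θ, M)` is not onto, a nonzero functional `ψ` kills its image, and `m ↦ (u ↦ ψ (m ∘
u))` is a `Λ`-map into the translate. Were it zero, `ψ` would vanish on all maps through `E`, whose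
sums exhaust `Hom_A(G₁, M)`. -/
theorem surjective_precomp_of_eq_zero (h₁ : IsFinSummand A E G₁)
    {θ : G₁ →ₗ[A] G₀} (hθ : ∀ φ : HomE A E M →ₗ[CMAuslander A E] tauG k A E θ, φ = 0) :
    Function.Surjective (fun h : G₀ →ₗ[A] M => h ∘ₗ θ) := by
  let _ : Module k M := Module.compHom M (algebraMap k A)
  have : IsScalarTower k A M := ⟨fun c a x => by
    rw [Algebra.smul_def, mul_smul]; rfl⟩
  let θ' : (G₀ →ₗ[A] M) →ₗ[k] (G₁ →ₗ[A] M) :=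
    { toFun := fun h => h ∘ₗ θ
      map_add' := fun _ _ => rfl
      map_smul' := fun _ _ => rfl }
  change Function.Surjective θ'
  by_contra hs
  rw [← LinearMap.range_eq_top] at hs
  obtain ⟨ψ, hψ0, hψ⟩ := Submodule.exists_le_ker_of_lt_top _ (lt_top_iff_ne_top.2 hs)
  apply hψ0
  obtain ⟨ι, _, r, i, hri⟩ := h₁
  let Φ : (E →ₗ[A] M) → DualHom k A E G₁ := fun m => ψ ∘ₗ
    ({ toFun := fun u => m ∘ₗ u
       map_add' := fun u v => LinearMap.comp_add u v m
       map_smul' := fun c u => LinearMap.ext fun x => m.map_smul_of_tower c (u x) } :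
      (G₁ →ₗ[A] E) →ₗ[k] (G₁ →ₗ[A] M))
  let φ : HomE A E M →ₗ[CMAuslander A E] tauG k A E θ :=
    { toFun := fun m => ⟨Φ (HomE.equiv A E M m), LinearMap.ext (R := k) (M := G₀ →ₗ[A] E) (M₃ := k)
        fun v => LinearMap.mem_ker.1 (hψ ⟨HomE.equiv A E M m ∘ₗ v, rfl⟩)⟩
      map_add' := fun m m' => Subtype.ext <|
        LinearMap.ext (R := k) (M := G₁ →ₗ[A] E) (M₃ := k) fun u =>
          map_add ψ (HomE.equiv A E M m ∘ₗ u) (HomE.equiv A E M m' ∘ₗ u)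
      map_smul' := fun c m => rfl }
  have hφ : ∀ m u, ψ (m ∘ₗ u) = 0 := fun m u =>
    congrArg (fun z => DualHom.eval (z : DualHom k A E G₁) u)
      (congrArg Subtype.val (LinearMap.congr_fun (hθ φ) ((HomE.equiv A E M).symm m)))
  refine LinearMap.ext fun h => ?_
  have h1 : h = ∑ j, (h ∘ₗ r j) ∘ₗ i j := by
    conv_lhs => rw [← LinearMap.comp_id h, ← hri]
    refine LinearMap.ext fun x => ?_
    simp [LinearMap.sum_apply]
  rw [h1, map_sum]
  exact Finset.sum_eq_zero fun j _ => hφ _ _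

end HomTranslate

/-! ### The class `D_θ` and comparison of presentations. -/

section Silting

variable {A : Type u} [Ring A] {G₁ G₀ : Type u} [AddCommGroup G₁] [Module A G₁]
  [AddCommGroup G₀] [Module A G₀]

theorem mem_DClass_of_retract {θ : G₁ →ₗ[A] G₀} {X Y : ModuleCat.{u} A} (hX : X ∈ DClass θ)
    (s : Y →ₗ[A] X) (t : X →ₗ[A] Y) (hts : t ∘ₗ s = LinearMap.id) : Y ∈ DClass θ := by
  intro h
  obtain ⟨h', hh'⟩ := hX (s ∘ₗ h)
  refine ⟨t ∘ₗ h', LinearMap.ext fun x => ?_⟩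
  have h1 := congrArg t (LinearMap.congr_fun hh' x)
  exact h1.trans (LinearMap.congr_fun hts (h x))

/-- Images lift maps from `G₁` and extensions lift maps from `G₀` along the `G`-epimorphism;
coproducts use that `G₁` is finitely generated. -/
theorem isRelativeTorsionClass_DClass (h₁ : IsGorensteinProjective A G₁)
    (h₀ : IsGorensteinProjective A G₀) (θ : G₁ →ₗ[A] G₀) :
    IsRelativeTorsionClass (DClass θ) where
  image X Y p hp hX h := by
    obtain ⟨h', rfl⟩ := hp.2 G₁ h₁ h
    obtain ⟨w, rfl⟩ := hX h'
    exact ⟨p ∘ₗ w, rfl⟩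
  extension X Y Z i p hip hX hZ h := by
    obtain ⟨hi, hex, hp⟩ := hip
    obtain ⟨z, hz⟩ := hZ (p ∘ₗ h)
    obtain ⟨y, rfl⟩ := hp.2 G₀ h₀ z
    have hr : ∀ x, (h - y ∘ₗ θ) x ∈ LinearMap.range i := fun x => by
      refine (hex _).1 ?_
      have := LinearMap.congr_fun hz x
      simp only [LinearMap.comp_apply] at this
      simp [this]
    let e := LinearEquiv.ofInjective i hi
    obtain ⟨x, hx⟩ := hX (e.symm.toLinearMap ∘ₗ (h - y ∘ₗ θ).codRestrict _ hr)
    refine ⟨y + i ∘ₗ x, LinearMap.ext fun g => ?_⟩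
    have h1 : x (θ g) = e.symm ⟨(h - y ∘ₗ θ) g, hr g⟩ := LinearMap.congr_fun hx g
    have h2 : i (x (θ g)) = (h - y ∘ₗ θ) g := by
      rw [h1]
      exact congrArg Subtype.val (e.apply_symm_apply ⟨(h - y ∘ₗ θ) g, hr g⟩)
    change y (θ g) + i (x (θ g)) = h g
    rw [h2]
    simp
  coproduct ι X hX h := by
    classical
    let h : G₁ →ₗ[A] DirectSum ι (fun i => X i) := h
    choose w hw using fun j => hX j (DirectSum.component A ι (fun i => X i) j ∘ₗ h)
    obtain ⟨t, ht⟩ := h₁.1.fg_top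
    -- A finite set of indices supporting the images of all generators of `G₁`, hence the image of
    -- `h`.
    let s := t.biUnion fun x => DFinsupp.support (h x)
    refine ⟨(∑ j ∈ s, DirectSum.lof A ι (fun i => X i) j ∘ₗ w j :
      G₀ →ₗ[A] DirectSum ι (fun i => X i)), ?_⟩
    refine LinearMap.ext_on ht fun x hx => ?_
    have hwx : ∀ j, w j (θ x) = h x j := fun j => LinearMap.congr_fun (hw j) x
    change (∑ j ∈ s, DirectSum.lof A ι (fun i => X i) j ∘ₗ w j :
      G₀ →ₗ[A] DirectSum ι (fun i => X i)) (θ x) = h x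
    simp only [LinearMap.sum_apply, LinearMap.comp_apply, hwx]
    conv_rhs => rw [← DirectSum.sum_support_of (h x)]
    refine (Finset.sum_subset (Finset.subset_biUnion_of_mem
      (fun x => DFinsupp.support (h x)) hx) fun j _ hj => ?_).symm
    rw [DFinsupp.notMem_support_iff.1 hj, map_zero]

theorem mem_DClass_of_inGenG (h₁ : IsGorensteinProjective A G₁)
    (h₀ : IsGorensteinProjective A G₀) {θ : G₁ →ₗ[A] G₀} {M Y : Type u} [AddCommGroup M]
    [Module A M] [AddCommGroup Y] [Module A Y] (hM : ModuleCat.of A M ∈ DClass θ)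
    (hY : InGenG A M Y) : ModuleCat.of A Y ∈ DClass θ := by
  classical
  obtain ⟨T, p, ⟨ι, i, r, hri⟩, hp⟩ := hY
  have ht := isRelativeTorsionClass_DClass h₁ h₀ θ
  refine ht.image T (ModuleCat.of A Y) p hp ?_
  let e := finsuppLEquivDirectSum A M ι
  refine mem_DClass_of_retract (ht.coproduct ι (fun _ => ModuleCat.of A M) fun _ => hM)
    (e.toLinearMap ∘ₗ i) (r ∘ₗ e.symm.toLinearMap) (LinearMap.ext fun x => ?_)
  have := LinearMap.congr_fun hri x
  simpa using this

/-- Properness gives comparison maps `a`, `b` both ways over `M`, and minimality makes the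
composites on the minimal side bijective. -/
theorem IsMinimalProperPresentation.surjective_precomp {G₁' G₀' M : Type u} [AddCommGroup G₁']
    [Module A G₁'] [AddCommGroup G₀'] [Module A G₀'] [AddCommGroup M] [Module A M]
    {f : G₁ →ₗ[A] G₀} {g : G₀ →ₗ[A] M} {θ : G₁' →ₗ[A] G₀'} {g' : G₀' →ₗ[A] M}
    (h : IsMinimalProperPresentation f g) (h' : IsProperPresentation θ g')
    (hθ : Function.Surjective (fun h : G₀' →ₗ[A] M => h ∘ₗ θ)) :
    Function.Surjective (fun h : G₀ →ₗ[A] M => h ∘ₗ f) := by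
  obtain ⟨a₀, ha₀⟩ := h'.hom_surjective G₀ h.gproj₀ g
  obtain ⟨b, hb⟩ := h.hom_surjective G₀' h'.gproj₀ g'
  replace ha₀ : ∀ x, g' (a₀ x) = g x := LinearMap.congr_fun ha₀
  replace hb : ∀ x, g (b x) = g' x := LinearMap.congr_fun hb
  let t := LinearEquiv.ofBijective (b ∘ₗ a₀)
    (h.minimal₀ _ (LinearMap.ext fun x => by simp [hb, ha₀]))
  have hgt : ∀ x, g (t.symm x) = g x := fun x => by
    obtain ⟨x, rfl⟩ := t.surjective x
    rw [t.symm_apply_apply]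
    simp [t, hb, ha₀]
  -- Normalised so that `b₀ ∘ a₀ = id` exactly; then `f ∘ b₁ ∘ a₁ = f`, and minimality of `f`
  -- applies.
  let b₀ := t.symm.toLinearMap ∘ₗ b
  have hba : ∀ x, b₀ (a₀ x) = x := t.symm_apply_apply
  obtain ⟨a₁, ha₁⟩ := (h'.hom_exact G₁ h.gproj₁ (a₀ ∘ₗ f)).1 (LinearMap.ext fun x => by
    simpa [ha₀] using (h.exact _).2 ⟨x, rfl⟩)
  obtain ⟨b₁, hb₁⟩ := (h.hom_exact G₁' h'.gproj₁ (b₀ ∘ₗ θ)).1 (LinearMap.ext fun x => by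
    simpa [b₀, hgt, hb] using (h'.exact _).2 ⟨x, rfl⟩)
  replace ha₁ : ∀ x, θ (a₁ x) = a₀ (f x) := LinearMap.congr_fun ha₁
  replace hb₁ : ∀ x, f (b₁ x) = b₀ (θ x) := LinearMap.congr_fun hb₁
  have hf : ∀ x, f (b₁ (a₁ x)) = f x := fun x => by rw [hb₁, ha₁, hba]
  have hs := (h.minimal₁.of_rangeRestrict (b₁ ∘ₗ a₁) (LinearMap.ext hf)).2
  intro u
  obtain ⟨w, hw⟩ := hθ (u ∘ₗ b₁)
  refine ⟨w ∘ₗ a₀, LinearMap.ext fun x => ?_⟩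
  obtain ⟨y, rfl⟩ := hs x
  have := LinearMap.congr_fun hw (a₁ y)
  simp only [LinearMap.comp_apply, ha₁] at this ⊢
  rw [hf, this]

end Silting

/-! ### Equivalent forms of `τ_G`-rigidity. -/

section Rigid

variable {k A : Type u} [Field k] [Ring A] [Algebra k A] [IsArtinianRing A]
  {E : Type u} [AddCommGroup E] [Module A E] [Module k E] [IsScalarTower k A E]
  {G₁ G₀ M : Type u} [AddCommGroup G₁] [Module A G₁] [AddCommGroup G₀] [Module A G₀]
  [AddCommGroup M] [Module A M]

theorem IsMinimalProperPresentation.isTauGRigid_iff (hE : IsGorensteinProjectiveGenerator A E)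
    {f : G₁ →ₗ[A] G₀} {g : G₀ →ₗ[A] M} (h : IsMinimalProperPresentation f g) :
    IsTauGRigid k A E M ↔ Function.Surjective (fun h : G₀ →ₗ[A] M => h ∘ₗ f) := by
  constructor
  · rintro ⟨G₁', G₀', f', g', h', hφ⟩
    exact h.surjective_precomp h'.toIsProperPresentation (surjective_precomp_of_eq_zero
      (isFinSummand_of_isGorensteinProjective hE h'.gproj₁) hφ)
  · intro hs
    exact ⟨ModuleCat.of A G₁, ModuleCat.of A G₀, f, g, h, eq_zero_of_surjective_precomp
      (isFinSummand_of_isGorensteinProjective hE h.gproj₁)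
      (isFinSummand_of_isGorensteinProjective hE h.gproj₀) hs⟩

theorem IsMinimalProperPresentation.isTauGRigid_iff_isPartialGorensteinSilting
    (hE : IsGorensteinProjectiveGenerator A E) {f : G₁ →ₗ[A] G₀} {g : G₀ →ₗ[A] M}
    (h : IsMinimalProperPresentation f g) :
    IsTauGRigid k A E M ↔ IsPartialGorensteinSilting A M := by
  rw [h.isTauGRigid_iff hE]
  constructor
  · intro hs
    exact ⟨ModuleCat.of A G₁, ModuleCat.of A G₀, f, g, h.toIsProperPresentation,
      isRelativeTorsionClass_DClass h.gproj₁ h.gproj₀ f, hs⟩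
  · rintro ⟨G₁', G₀', θ, g', h', -, hM⟩
    exact h.surjective_precomp h' hM

theorem IsMinimalProperPresentation.isTauGRigid_iff_isTauRigid
    (hE : IsGorensteinProjectiveGenerator A E) {f : G₁ →ₗ[A] G₀} {g : G₀ →ₗ[A] M}
    (h : IsMinimalProperPresentation f g) :
    IsTauGRigid k A E M ↔ IsTauRigid k (CMAuslander A E) (HomE A E M) := by
  constructor
  · rintro ⟨G₁', G₀', f', g', h', hφ⟩
    have hF := h'.homE_map hE
    obtain ⟨e⟩ := h'.nonempty_tauG_equiv_tau (k := k) hE hF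
    refine ⟨ModuleCat.of _ (HomE A E G₁'), ModuleCat.of _ (HomE A E G₀'), HomE.map E f',
      HomE.map E g', hF, fun φ => LinearMap.ext fun m => ?_⟩
    have := LinearMap.congr_fun (hφ (e.symm.toLinearMap ∘ₗ φ)) m
    exact e.symm.map_eq_zero_iff.1 this
  · rintro ⟨P₁, P₀, p, q, hpq, hφ⟩
    obtain ⟨e⟩ := h.nonempty_tauG_equiv_tau (k := k) hE hpq
    refine ⟨ModuleCat.of A G₁, ModuleCat.of A G₀, f, g, h, fun φ => LinearMap.ext fun m => ?_⟩
    have := LinearMap.congr_fun (hφ (e.toLinearMap ∘ₗ φ)) m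
    exact e.map_eq_zero_iff.1 this

/-- The zero map factors through the zero module, which is injective. -/
theorem stablyOrthogonal_of_eq_zero {L X Y : Type u} [Ring L] [AddCommGroup X] [Module L X]
    [AddCommGroup Y] [Module L Y] [Module.Finite L X] (h : ∀ φ : X →ₗ[L] Y, φ = 0) :
    StablyOrthogonal L X Y := by
  refine ⟨‹_›, fun φ => ⟨ModuleCat.of L PUnit.{u + 1}, 0, 0,
    inferInstanceAs (Module.Finite L PUnit.{u + 1}), ⟨fun _ _ _ _ _ _ _ _ _ => ⟨0, fun _ =>
      Subsingleton.elim (α := PUnit) _ _⟩⟩, ?_⟩⟩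
  rw [h φ, LinearMap.comp_zero]

end Rigid

end GorensteinSilting

open GorensteinSilting in
theorem mainTheorem1 (k A : Type u) [Field k] [Ring A] [Algebra k A] [FiniteDimensional k A]
    (hA : FiniteCMType A)
    (E : Type u) [AddCommGroup E] [Module A E] [Module k E] [IsScalarTower k A E]
    (hE : IsGorensteinProjectiveGenerator A E)
    (M : Type u) [AddCommGroup M] [Module A M] [Module.Finite A M] :
    -- the minimal presentations used to define `τ_G M` and `τ Hom_A(E, M)` exist
    (∃ (G₁ G₀ : ModuleCat.{u} A) (f : G₁ →ₗ[A] G₀) (g : G₀ →ₗ[A] M),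
      IsMinimalProperPresentation f g) ∧
    (∃ (P₁ P₀ : ModuleCat.{u} (CMAuslander A E)) (p : P₁ →ₗ[CMAuslander A E] P₀)
      (q : P₀ →ₗ[CMAuslander A E] HomE A E M), IsMinimalProjectivePresentation p q) ∧
    -- `τ_G`-rigid = partial Gorenstein silting
    (IsTauGRigid k A E M ↔ IsPartialGorensteinSilting A M) ∧
    -- `M` is `τ_G`-rigid iff `Hom_A(E, M)` is `τ`-rigid
    (IsTauGRigid k A E M ↔ IsTauRigid k (CMAuslander A E) (HomE A E M)) ∧
    (∀ (G₁ G₀ : Type u) [AddCommGroup G₁] [Module A G₁] [AddCommGroup G₀] [Module A G₀]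
      (f : G₁ →ₗ[A] G₀) (g : G₀ →ₗ[A] M), IsMinimalProperPresentation f g →
      -- `M` is `τ_G`-rigid iff `Hom_A(f, M)` is surjective
      (IsTauGRigid k A E M ↔ Function.Surjective (fun h : G₀ →ₗ[A] M => h ∘ₗ f)) ∧
      -- `τ_G M ≅ τ Hom_A(E, M)`
      (∀ (P₁ P₀ : Type u) [AddCommGroup P₁] [Module (CMAuslander A E) P₁]
        [AddCommGroup P₀] [Module (CMAuslander A E) P₀]
        (p : P₁ →ₗ[CMAuslander A E] P₀) (q : P₀ →ₗ[CMAuslander A E] HomE A E M),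
        IsMinimalProjectivePresentation p q →
          Nonempty (tauG k A E f ≃ₗ[CMAuslander A E] tau k (CMAuslander A E) p)) ∧
      -- if `M` is `τ_G`-rigid, then `Hom_A(E, Gen_G M)` is stably left orthogonal to `τ_G M`
      (IsTauGRigid k A E M →
        ∀ (Y : Type u) [AddCommGroup Y] [Module A Y], Module.Finite A Y → InGenG A M Y →
          StablyOrthogonal (CMAuslander A E) (HomE A E Y) (tauG k A E f))) := by
  have : IsArtinianRing A := IsArtinianRing.of_finite k A
  have : Module.Finite A E := hE.isGorensteinProjective.1
  obtain ⟨G₁, G₀, f, g, h⟩ := exists_isMinimalProperPresentation (M := M) hE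
    fun N _ _ _ => finite_homE k N
  refine ⟨⟨G₁, G₀, f, g, h⟩, ⟨ModuleCat.of _ (HomE A E G₁), ModuleCat.of _ (HomE A E G₀),
    HomE.map E f, HomE.map E g, h.homE_map hE⟩, h.isTauGRigid_iff_isPartialGorensteinSilting hE,
    h.isTauGRigid_iff_isTauRigid hE, fun G₁ G₀ _ _ _ _ f g h => ⟨h.isTauGRigid_iff hE,
    fun P₁ P₀ _ _ _ _ p q hpq => h.nonempty_tauG_equiv_tau hE hpq, fun hM Y _ _ _ hY => ?_⟩⟩
  have := finite_homE k (A := A) (E := E) Y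
  -- The duality is applied to `Y` in place of `M`, with the same `f`: by (c) `M` is in `D_f`, hence
  -- so is `Y`.
  exact stablyOrthogonal_of_eq_zero (eq_zero_of_surjective_precomp
    (isFinSummand_of_isGorensteinProjective hE h.gproj₁)
    (isFinSummand_of_isGorensteinProjective hE h.gproj₀)
    (mem_DClass_of_inGenG h.gproj₁ h.gproj₀ ((h.isTauGRigid_iff hE).1 hM) hY))
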